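/- All graphs are finite, simple and undirected. A diamond is the graph obtained from the complete graph $K_4$ by removing one edge. For a set $\mathcal H$ of graphs, a graph is $\mathcal H$-free if it contains no induced subgraph isomorphic to a member of $\mathcal H$. An instance of $\mathcal H$-free Edge Deletion is a pair $(G,k)$ of a graph $G$ and an integer $k\ge 0$; it is a yes-instance if there is a set $S\subseteq E(G)$ with $|S|\le k$ such that $G-S$ is $\mathcal H$-free, and a no-instance otherwise. Theorem. (1) There are a constant $C$ and an algorithm that, given an instance $(G,k)$ of Diamond-free Edge Deletion (the case $\mathcal H=\{\text{diamond}\}$), runs in time polynomial in $|V(G)|+k$ and either correctly declares that $(G,k)$ is a no-instance or outputs an instance $(G',k')$ of the same problem such that $(G,k)$ is a yes-instance if and only if $(G',k')$ is a yes-instance, $|V(G')|\le C\,k^3$ and $k'\le k$. (2) For every fixed integer $t\ge 4$ there are a constant $C$ (depending on $t$ only) and an algorithm that, given an instance $(G,k)$ of $\{\text{Diamond},K_t\}$-free Edge Deletion (the case $\mathcal H=\{\text{diamond},K_t\}$), runs in time polynomial in $|V(G)|+k$ (the polynomial may depend on $t$) and either correctly declares that $(G,k)$ is a no-instance or outputs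 an instance $(G',k')$ of the same problem such that $(G,k)$ is a yes-instance if and only if $(G',k')$ is a yes-instance, $|V(G')|\le C\,k^2$ and $k'\le k$. Here an algorithm is a program of a random access machine with unit-cost addition, truncated subtraction and indirect addressing; graphs are given by adjacency matrices, and running time is the number of elementary steps. -/

import Mathlib

/-! ### Edge deletion problems -/

namespace EdgeDeletion

open scoped SimpleGraph

/-- A set of finite graphs, each given on a vertex set `Fin m`. -/
abbrev GraphFamily : Type := Set (Σ m : ℕ, SimpleGraph (Fin m))

/-- `G` is `ℋ`-free: it contains no induced copy of any `H ∈ ℋ`. -/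
def IsFree (ℋ : GraphFamily) {V : Type*} (G : SimpleGraph V) : Prop :=
  ∀ H ∈ ℋ, ¬ H.2.IsIndContained G

/-- `(G, k)` is a yes-instance of `ℋ`-free Edge Deletion: at most `k` edges of `G` can be
deleted such that the remaining graph is `ℋ`-free. -/
def IsYes (ℋ : GraphFamily) {V : Type*} (G : SimpleGraph V) (k : ℕ) : Prop :=
  ∃ S : Finset (Sym2 V), (S : Set (Sym2 V)) ⊆ G.edgeSet ∧ S.card ≤ k ∧
    IsFree ℋ (G.deleteEdges (S : Set (Sym2 V)))

/-- The diamond: the complete graph on four vertices with one edge removed. -/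
def diamond : SimpleGraph (Fin 4) :=
  (⊤ : SimpleGraph (Fin 4)).deleteEdges {s(0, 1)}

/-- The family `{diamond}`. -/
def diamondFamily : GraphFamily := {⟨4, diamond⟩}

/-- The family `{diamond, K_t}`. -/
def diamondCliqueFamily (t : ℕ) : GraphFamily :=
  {⟨4, diamond⟩, ⟨t, (⊤ : SimpleGraph (Fin t))⟩}

/-! ### A random access machine with a step count

A program is a structured program over countably many registers (a fixed program only touches
finitely many) and a memory with indirect addressing; registers and memory cells hold natural
numbers. Arithmetic is restricted to addition and truncated subtraction (no multiplication), so
that the bit length of every number grows by at most one per unit of cost: the usual unit-cost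
random access machine, which is polynomially equivalent to Turing machines. -/

/-- The state of the machine. -/
structure State where
  reg : ℕ → ℕ
  mem : ℕ → ℕ

/-- Expressions: constants, registers, the content of an addressed memory cell, addition and
truncated subtraction. -/
inductive Expr where
  | const (c : ℕ)
  | reg (x : ℕ)
  | mem (e : Expr)
  | add (e₁ e₂ : Expr)
  | sub (e₁ e₂ : Expr)

/-- The value of an expression. -/
def Expr.eval (s : State) : Expr → ℕ
  | .const c => c
  | .reg x => s.reg x
  | .mem e => s.mem (e.eval s)
  | .add e₁ e₂ => e₁.eval s + e₂.eval s
  | .sub e₁ e₂ => e₁.eval s - e₂.eval s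

/-- The cost of evaluating an expression: one unit for each node. -/
def Expr.cost : Expr → ℕ
  | .const _ => 1
  | .reg _ => 1
  | .mem e => e.cost + 1
  | .add e₁ e₂ => e₁.cost + e₂.cost + 1
  | .sub e₁ e₂ => e₁.cost + e₂.cost + 1

/-- Programs. `assign x e` sets register `x` to the value of `e`; `store a e` writes the value
of `e` to the memory cell whose address is the value of `a`; the conditions of `ite` and `loop`
(a while loop) are true when their value is nonzero. -/
inductive Program where
  | skip
  | assign (x : ℕ) (e : Expr)
  | store (a e : Expr)
  | seq (P Q : Program)
  | ite (e : Expr) (P Q : Program)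
  | loop (e : Expr) (P : Program)

/-- `Exec P s c s'`: started in state `s`, the program `P` halts in state `s'` after a
computation of cost exactly `c`. -/
inductive Exec : Program → State → ℕ → State → Prop where
  | skip (s : State) : Exec .skip s 1 s
  | assign (x : ℕ) (e : Expr) (s : State) :
      Exec (.assign x e) s (e.cost + 1) ⟨Function.update s.reg x (e.eval s), s.mem⟩
  | store (a e : Expr) (s : State) :
      Exec (.store a e) s (a.cost + e.cost + 1)
        ⟨s.reg, Function.update s.mem (a.eval s) (e.eval s)⟩
  | seq {P Q : Program} {s s' s'' : State} {c d : ℕ} :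
      Exec P s c s' → Exec Q s' d s'' → Exec (.seq P Q) s (c + d) s''
  | iteTrue {e : Expr} {P Q : Program} {s s' : State} {c : ℕ} :
      e.eval s ≠ 0 → Exec P s c s' → Exec (.ite e P Q) s (e.cost + 1 + c) s'
  | iteFalse {e : Expr} {P Q : Program} {s s' : State} {c : ℕ} :
      e.eval s = 0 → Exec Q s c s' → Exec (.ite e P Q) s (e.cost + 1 + c) s'
  | loopTrue {e : Expr} {P : Program} {s s' s'' : State} {c d : ℕ} :
      e.eval s ≠ 0 → Exec P s c s' → Exec (.loop e P) s' d s'' →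
        Exec (.loop e P) s (e.cost + 1 + c + d) s''
  | loopFalse {e : Expr} {P : Program} {s : State} :
      e.eval s = 0 → Exec (.loop e P) s (e.cost + 1) s

/-- The machine is deterministic: cost and final state are determined by the initial state. -/
theorem Exec.deterministic {P : Program} {s s₁ s₂ : State} {c₁ c₂ : ℕ}
    (h₁ : Exec P s c₁ s₁) (h₂ : Exec P s c₂ s₂) : c₁ = c₂ ∧ s₁ = s₂ := by
  induction h₁ generalizing c₂ s₂ with
  | skip s => cases h₂; exact ⟨rfl, rfl⟩
  | assign x e s => cases h₂; exact ⟨rfl, rfl⟩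
  | store a e s => cases h₂; exact ⟨rfl, rfl⟩
  | seq _ _ ih₁ ih₂ =>
    cases h₂ with
    | seq k₁ k₂ =>
      obtain ⟨rfl, rfl⟩ := ih₁ k₁
      obtain ⟨rfl, rfl⟩ := ih₂ k₂
      exact ⟨rfl, rfl⟩
  | iteTrue he _ ih =>
    cases h₂ with
    | iteTrue _ k => obtain ⟨rfl, rfl⟩ := ih k; exact ⟨rfl, rfl⟩
    | iteFalse he' _ => exact absurd he' he
  | iteFalse he _ ih =>
    cases h₂ with
    | iteTrue he' _ => exact absurd he he'
    | iteFalse _ k => obtain ⟨rfl, rfl⟩ := ih k; exact ⟨rfl, rfl⟩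
  | loopTrue he _ _ ih₁ ih₂ =>
    cases h₂ with
    | loopTrue _ k₁ k₂ =>
      obtain ⟨rfl, rfl⟩ := ih₁ k₁
      obtain ⟨rfl, rfl⟩ := ih₂ k₂
      exact ⟨rfl, rfl⟩
    | loopFalse he' => exact absurd he' he
  | loopFalse he =>
    cases h₂ with
    | loopTrue he' _ _ => exact absurd he he'
    | loopFalse _ => exact ⟨rfl, rfl⟩

/-! ### Instances as inputs and outputs of programs -/

/-- The state `s` holds the instance `(G, k)`, where `G` has vertex set `{0, …, n - 1}`:
register `0` holds `n`, register `1` holds `k`, and the cells `0, …, n² - 1` of the memory hold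
the adjacency matrix of `G`, row by row. -/
def Holds (s : State) {n : ℕ} (G : SimpleGraph (Fin n)) (k : ℕ) : Prop :=
  s.reg 0 = n ∧ s.reg 1 = k ∧
    ∀ i j : Fin n,
      (G.Adj i j → s.mem (i * n + j) = 1) ∧ (¬ G.Adj i j → s.mem (i * n + j) = 0)

open Classical in
/-- The initial state on input `(G, k)`: it holds `(G, k)`, and every other register and memory
cell is `0`. -/
noncomputable def inputState {n : ℕ} (G : SimpleGraph (Fin n)) (k : ℕ) : State where
  reg x := if x = 0 then n else if x = 1 then k else 0
  mem a := if ∃ i j : Fin n, a = i * n + j ∧ G.Adj i j then 1 else 0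

/-- The initial state on input `(G, k)` holds `(G, k)`. -/
theorem holds_inputState {n : ℕ} (G : SimpleGraph (Fin n)) (k : ℕ) :
    Holds (inputState G k) G k := by
  refine ⟨by simp [inputState], by simp [inputState], fun i j => ⟨fun h => ?_, fun h => ?_⟩⟩
  · simp only [inputState]
    exact if_pos ⟨i, j, rfl, h⟩
  · simp only [inputState]
    refine if_neg ?_
    rintro ⟨i', j', e, h'⟩
    have hn : 0 < n := i.pos
    have hj : (j : ℕ) = j' := by
      have := congrArg (· % n) e
      simpa [Nat.add_mod, Nat.mod_eq_of_lt j.2, Nat.mod_eq_of_lt j'.2]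
        using this
    have hi : (i : ℕ) = i' := by
      have e' : (i : ℕ) * n = i' * n := by omega
      exact Nat.eq_of_mul_eq_mul_right hn e'
    rw [Fin.ext hi, Fin.ext hj] at h
    exact h h'

/-- `ℋ`-free Edge Deletion has a polynomial-time kernelization with at most `b k` vertices that
does not increase the parameter: a single program that, on every instance `(G, k)`, halts after
a number of steps polynomial in `|V(G)| + k` and

* either declares (by the value `1` in register `2`) that `(G, k)` is a no-instance, which is
  then the case,
* or outputs (with the value `0` in register `2`) an equivalent instance `(G', k')` with
  `|V(G')| ≤ b k` and `k' ≤ k`. -/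
def HasKernelization (ℋ : GraphFamily) (b : ℕ → ℕ) : Prop :=
  ∃ (P : Program) (p : Polynomial ℕ), ∀ (n : ℕ) (G : SimpleGraph (Fin n)) (k : ℕ),
    ∃ (c : ℕ) (s : State), Exec P (inputState G k) c s ∧ c ≤ p.eval (n + k) ∧
      ((s.reg 2 = 1 ∧ ¬ IsYes ℋ G k) ∨
        (s.reg 2 = 0 ∧ ∃ (n' : ℕ) (G' : SimpleGraph (Fin n')) (k' : ℕ),
          Holds s G' k' ∧ (IsYes ℋ G k ↔ IsYes ℋ G' k') ∧ n' ≤ b k ∧ k' ≤ k))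

end EdgeDeletion

/-! The kernel comes from three rules, each applied to an edge `qw` and its hull: `q`, `w` and their
common neighbours. Closed clique: if the hull is a clique, no triangle with an edge in it leaves it,
and it is smaller than a forbidden clique, then all its edges may be removed (`yes_closedClique`).
Forced edge: if `qw` is the diagonal of so many diamonds that `k` deletions elsewhere cannot destroy
them all, it belongs to every solution, so it is removed and `k` drops by one (`yes_forcedEdge`).
Detaching, used only when no clique is forbidden: a clique on at least `2k + 3` vertices cannot
usefully be touched, so `q` may be cut off from it when no triangle through an edge from `q` into it
leaves it and every outside vertex misses one of its vertices other than `q` (`yes_detach`).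

Size bound: suppose no rule applies and `S` is a solution; it has at most `2k` ends. Since the
closed clique rule fails, every non-isolated vertex that is not an end lies in a petal, the set of
non-ends in `N(x) ∩ N[b]`, where `b` is a non-end common neighbour of two adjacent ends `x`, `y`
(`exists_adj_ends`). For each ordered pair of ends a maximum independent set of such `b` yields
petals covering all others: one if `xy` survives, at most `k + 1` if it is deleted, because the
forced edge rule fails. Altogether `8k²` petals suffice (`card_nonisolated_le`). Petals are cliques;
they have fewer than `t` vertices if `K_t` is forbidden, and at most `2k + 2` if the detaching rule
fails. This gives the quadratic and the cubic bound. Isolated vertices are dropped at the end, and a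
remainder above the bound certifies a no-instance.

Running time: rule conditions and new adjacency matrices are all written as counting terms `Tm`,
which `Tm.runs_compile` turns into polynomial-time programs once and for all. Every rule deletes at
least the edge `qw`, so the main loop makes at most `n²` rounds (`ReductionRule.hasKernelization`).
-/

namespace EdgeDeletion

/-! ### Reformulation of the deletion problem -/

variable {V W : Type*}

/-- No induced diamond and, for `t ≠ 0`, no clique on `t` vertices. -/
def FreeOf (t : ℕ) (G : SimpleGraph V) : Prop :=
  (∀ a b c d, G.Adj a c → G.Adj a d → G.Adj b c → G.Adj b d → G.Adj c d → a ≠ b → G.Adj a b) ∧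
    (t ≠ 0 → G.CliqueFree t)

/-- Some set of at most `k` pairs can be removed from `G` to make it `FreeOf t`. -/
def Yes (t : ℕ) (G : SimpleGraph V) (k : ℕ) : Prop :=
  ∃ S : Finset (Sym2 V), S.card ≤ k ∧ FreeOf t (G.deleteEdges (S : Set (Sym2 V)))

/-- The tips of the diamond are `a` and `b`, its diagonal is `cd`. Diamond-freeness thus says that
any two common neighbours of an edge are adjacent, which is how it is used everywhere below. -/
theorem not_diamond_isIndContained_iff (G : SimpleGraph V) :
    ¬ diamond.IsIndContained G ↔
      ∀ a b c d, G.Adj a c → G.Adj a d → G.Adj b c → G.Adj b d → G.Adj c d → a ≠ b →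
        G.Adj a b := by
  constructor
  · intro h a b c d hac had hbc hbd hcd hab
    by_contra hn
    apply h
    have e : Function.Injective ![a, b, c, d] := by
      have h1 := hac.ne; have h2 := had.ne; have h3 := hbc.ne
      have h4 := hbd.ne; have h5 := hcd.ne
      intro i j hij
      fin_cases i <;> fin_cases j <;> simp_all [eq_comm]
    refine ⟨⟨⟨![a, b, c, d], e⟩, ?_⟩⟩
    intro i j
    fin_cases i <;> fin_cases j <;>
      simp [diamond, hac, had, hbc, hbd, hcd, hac.symm, had.symm, hbc.symm, hbd.symm, hcd.symm,
        hn, mt SimpleGraph.Adj.symm hn]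
  · rintro h ⟨f⟩
    have key : ∀ i j, G.Adj (f i) (f j) ↔ diamond.Adj i j := fun i j => f.map_adj_iff
    have := h (f 0) (f 1) (f 2) (f 3) ((key _ _).2 (by simp [diamond]))
      ((key _ _).2 (by simp [diamond])) ((key _ _).2 (by simp [diamond]))
      ((key _ _).2 (by simp [diamond])) ((key _ _).2 (by simp [diamond]))
      (fun h => by simpa using f.injective h)
    rw [key] at this
    simp [diamond] at this

theorem isFree_diamondFamily_iff (G : SimpleGraph V) :
    IsFree diamondFamily G ↔ FreeOf 0 G := by
  simp [IsFree, diamondFamily, FreeOf, not_diamond_isIndContained_iff]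

theorem isFree_diamondCliqueFamily_iff {t : ℕ} (ht : t ≠ 0) (G : SimpleGraph V) :
    IsFree (diamondCliqueFamily t) G ↔ FreeOf t G := by
  have : ¬ (⊤ : SimpleGraph (Fin t)).IsIndContained G ↔ G.CliqueFree t := by
    rw [not_iff_comm, SimpleGraph.not_cliqueFree_iff_top_isContained]
    exact ⟨fun ⟨f⟩ => ⟨f.topEmbedding⟩, fun h => h.isContained⟩
  simp only [IsFree, diamondCliqueFamily, Set.mem_insert_iff, Set.mem_singleton_iff, forall_eq_or_imp,
    forall_eq, not_diamond_isIndContained_iff, this, FreeOf, ne_eq, ht, not_false_eq_true,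
    true_imp_iff]

/-- Deleting a pair that is not an edge has no effect, so solutions need not be kept inside the edge
set while the graph changes. -/
theorem isYes_iff_yes {ℋ : GraphFamily} {t : ℕ}
    (h : ∀ G : SimpleGraph V, IsFree ℋ G ↔ FreeOf t G) (G : SimpleGraph V) (k : ℕ) :
    IsYes ℋ G k ↔ Yes t G k := by
  classical
  constructor
  · rintro ⟨S, -, hS, hf⟩
    exact ⟨S, hS, (h _).1 hf⟩
  · rintro ⟨S, hS, hf⟩
    refine ⟨S.filter (· ∈ G.edgeSet), by intro e; simp,
      (Finset.card_filter_le _ _).trans hS, (h _).2 ?_⟩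
    convert hf using 1
    ext a b
    simp only [SimpleGraph.deleteEdges_adj, Finset.coe_filter, Set.mem_ofPred_eq,
      SimpleGraph.mem_edgeSet, Finset.mem_coe]
    tauto

/-- Vertices outside the range of `f` are isolated and lie in no forbidden subgraph. The exception
is `K_1`, which the new vertices would create when `V` is empty; hence `t ≠ 1`. -/
theorem freeOf_map_iff {t : ℕ} (ht : t ≠ 1) (f : V ↪ W) (G : SimpleGraph V) :
    FreeOf t (G.map f) ↔ FreeOf t G := by
  have hc : (t ≠ 0 → (G.map f).CliqueFree t) ↔ (t ≠ 0 → G.CliqueFree t) := by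
    refine imp_congr_right fun h0 => ?_
    rcases isEmpty_or_nonempty V with hV | hV
    · have e1 : G = ⊥ := Subsingleton.elim _ _
      subst e1
      have e2 : (⊥ : SimpleGraph V).map f = ⊥ := by
        ext a b
        simp [SimpleGraph.map_adj]
      rw [e2]
      exact iff_of_true (SimpleGraph.cliqueFree_bot (by omega))
        (SimpleGraph.cliqueFree_bot (by omega))
    · exact SimpleGraph.cliqueFree_map_iff
  refine and_congr ⟨fun h a b c d hac had hbc hbd hcd hab => ?_,
    fun h a b c d hac had hbc hbd hcd hab => ?_⟩ hc
  · have := h (f a) (f b) (f c) (f d)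
    simp only [SimpleGraph.map_adj_apply, ne_eq, EmbeddingLike.apply_eq_iff_eq] at this
    exact this hac had hbc hbd hcd hab
  · obtain ⟨a, c, hac', rfl, rfl⟩ := SimpleGraph.map_adj .. |>.1 hac
    obtain ⟨b, d, hbd', rfl, rfl⟩ := SimpleGraph.map_adj .. |>.1 hbd
    simp only [SimpleGraph.map_adj_apply] at *
    exact h a b c d hac had hbc hbd hcd (fun h => hab (by rw [h]))

theorem map_deleteEdges (f : V ↪ W) (G : SimpleGraph V) (S : Set (Sym2 W)) :
    (G.map f).deleteEdges S = (G.deleteEdges (Sym2.map f ⁻¹' S)).map f := by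
  ext a b
  simp only [SimpleGraph.deleteEdges_adj, SimpleGraph.map_adj, Set.mem_preimage]
  constructor
  · rintro ⟨⟨u, v, h, rfl, rfl⟩, h'⟩
    exact ⟨u, v, ⟨h, by simpa using h'⟩, rfl, rfl⟩
  · rintro ⟨u, v, ⟨h, h'⟩, rfl, rfl⟩
    exact ⟨⟨u, v, h, rfl, rfl⟩, by simpa using h'⟩

theorem yes_map_iff {t : ℕ} (ht : t ≠ 1) (f : V ↪ W) (G : SimpleGraph V) (k : ℕ) :
    Yes t (G.map f) k ↔ Yes t G k := by
  classical
  have hinj : Function.Injective (Sym2.map f) := Sym2.map.injective f.injective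
  constructor
  · rintro ⟨S, hS, hf⟩
    refine ⟨S.preimage _ hinj.injOn, ?_, ?_⟩
    · refine le_trans ?_ hS
      rw [← Finset.card_image_of_injective _ hinj]
      refine Finset.card_le_card fun e he => ?_
      simp only [Finset.mem_image, Finset.mem_preimage] at he
      obtain ⟨e, he, rfl⟩ := he
      exact he
    · rw [map_deleteEdges, freeOf_map_iff ht] at hf
      simpa using hf
  · rintro ⟨S, hS, hf⟩
    refine ⟨S.image (Sym2.map f), Finset.card_image_le.trans hS, ?_⟩
    rw [map_deleteEdges, freeOf_map_iff ht, Finset.coe_image, Set.preimage_image_eq _ hinj]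
    exact hf

/-! ### Soundness of the three reduction rules -/

/-- The end vertices of a set of pairs. -/
def ends [DecidableEq V] (S : Finset (Sym2 V)) : Finset V := S.biUnion Sym2.toFinset

theorem card_ends_le [DecidableEq V] (S : Finset (Sym2 V)) : (ends S).card ≤ 2 * S.card := by
  rw [mul_comm]
  refine Finset.card_biUnion_le_card_mul _ _ _ fun e _ => ?_
  rw [Sym2.card_toFinset]
  split_ifs <;> omega

theorem mem_ends_left [DecidableEq V] {S : Finset (Sym2 V)} {a b : V} (h : s(a, b) ∈ S) :
    a ∈ ends S := by
  simp only [ends, Finset.mem_biUnion]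
  exact ⟨_, h, by simp⟩

theorem mem_ends_right [DecidableEq V] {S : Finset (Sym2 V)} {a b : V} (h : s(a, b) ∈ S) :
    b ∈ ends S :=
  mem_ends_left (Sym2.eq_swap ▸ h)

/-- A set closed under common neighbours of adjacent members contains a diamond as soon as it
contains one of its edges. -/
theorem diamond_subset_or {R : V → V → Prop} (hs : ∀ {x y}, R x y → R y x) {K : Finset V}
    (tri : ∀ x y z, R x y → R x z → R y z → y ∈ K → z ∈ K → x ∈ K) {a b c d : V}
    (hac : R a c) (had : R a d) (hbc : R b c) (hbd : R b d) (hcd : R c d) :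
    (a ∈ K ∧ b ∈ K) ∨ (¬ (a ∈ K ∧ c ∈ K) ∧ ¬ (a ∈ K ∧ d ∈ K) ∧ ¬ (b ∈ K ∧ c ∈ K) ∧
      ¬ (b ∈ K ∧ d ∈ K) ∧ ¬ (c ∈ K ∧ d ∈ K)) := by
  -- All rotations of the triangles `acd` and `bcd`: two vertices in `K` force the third, so one
  -- edge inside `K` pulls in the diagonal and then both tips.
  have e1 := tri _ _ _ hac had hcd
  have e2 := tri _ _ _ hbc hbd hcd
  have e3 := tri _ _ _ (hs hac) hcd had
  have e4 := tri _ _ _ (hs hbc) hcd hbd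
  have e5 := tri _ _ _ (hs had) (hs hcd) hac
  have e6 := tri _ _ _ (hs hbd) (hs hcd) hbc
  clear tri hs hac had hbc hbd hcd
  by_cases ha : a ∈ K <;> by_cases hb : b ∈ K <;> by_cases hc : c ∈ K <;> by_cases hd : d ∈ K <;>
    simp_all

/-- Deleting all edges of a clique that shares no edge with a triangle leaving it, and that is too
small to contain a forbidden clique, gives an equivalent instance. -/
theorem yes_closedClique {t k : ℕ} {G G₁ : SimpleGraph V} {K : Finset V}
    (hK : ∀ a ∈ K, ∀ b ∈ K, a ≠ b → G.Adj a b)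
    (hcl : ∀ a ∈ K, ∀ b ∈ K, a ≠ b → ∀ c, G.Adj a c → G.Adj b c → c ∈ K)
    (ht : t ≠ 0 → K.card < t)
    (hG₁ : ∀ a b, G₁.Adj a b ↔ G.Adj a b ∧ ¬ (a ∈ K ∧ b ∈ K)) :
    Yes t G k ↔ Yes t G₁ k := by
  classical
  constructor
  · rintro ⟨S, hS, h1, h2⟩
    -- The same set works: were both tips of a diamond in `K`, closedness would put `c` there too,
    -- and the edge `ac` would be gone from `G₁`.
    refine ⟨S, hS, ?_, fun h0 => (h2 h0).anti ?_⟩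
    · intro a b c d
      have := h1 a b c d
      simp only [SimpleGraph.deleteEdges_adj, hG₁] at *
      intro hac had hbc hbd hcd hab
      refine ⟨⟨(this ⟨hac.1.1, hac.2⟩ ⟨had.1.1, had.2⟩ ⟨hbc.1.1, hbc.2⟩ ⟨hbd.1.1, hbd.2⟩
        ⟨hcd.1.1, hcd.2⟩ hab).1, fun h => hac.1.2 ⟨h.1, ?_⟩⟩, (this ⟨hac.1.1, hac.2⟩
        ⟨had.1.1, had.2⟩ ⟨hbc.1.1, hbc.2⟩ ⟨hbd.1.1, hbd.2⟩ ⟨hcd.1.1, hcd.2⟩ hab).2⟩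
      exact hcl a h.1 b h.2 hab c hac.1.1 hbc.1.1
    · intro a b
      simp only [SimpleGraph.deleteEdges_adj, hG₁]
      tauto
  · rintro ⟨S, hS, h1, h2⟩
    -- The filter drops the pairs inside `K`, phrased without naming the two ends. All edges of `K`
    -- then survive, and a potential diamond or clique either lies inside `K` or uses no edge of `K`
    -- and is handled by the solution of `G₁`.
    have hm : ∀ a b, s(a, b) ∈ S.filter (fun e => ∀ v ∈ e, v ∈ K → ∃ u ∈ e, u ∉ K) ↔
        s(a, b) ∈ S ∧ ¬ (a ∈ K ∧ b ∈ K) := by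
      intro a b
      simp only [Finset.mem_filter, Sym2.mem_iff, forall_eq_or_imp, forall_eq, exists_eq_or_imp,
        exists_eq_left]
      tauto
    refine ⟨S.filter (fun e => ∀ v ∈ e, v ∈ K → ∃ u ∈ e, u ∉ K),
      (Finset.card_filter_le _ _).trans hS, ?_⟩
    have hH : ∀ a b, (G.deleteEdges ((S.filter (fun e => ∀ v ∈ e, v ∈ K → ∃ u ∈ e, u ∉ K) :
        Finset (Sym2 V)) : Set (Sym2 V))).Adj a b ↔
        G.Adj a b ∧ ((a ∈ K ∧ b ∈ K) ∨ s(a, b) ∉ S) := by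
      intro a b
      rw [SimpleGraph.deleteEdges_adj, Finset.mem_coe, hm]
      tauto
    constructor
    · intro a b c d
      have := h1 a b c d
      simp only [hH]
      simp only [SimpleGraph.deleteEdges_adj, hG₁, Finset.mem_coe] at this
      intro hac had hbc hbd hcd hab
      rcases diamond_subset_or (R := G.Adj) (K := K) SimpleGraph.Adj.symm (fun x y z h1 h2 h3 hy hz =>
        hcl y hy z hz h3.ne x h1.symm h2.symm) hac.1 had.1 hbc.1 hbd.1 hcd.1 with h | h
      · exact ⟨hK a h.1 b h.2 hab, .inl h⟩
      · have h' := this ⟨⟨hac.1, h.1⟩, hac.2.resolve_left h.1⟩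
          ⟨⟨had.1, h.2.1⟩, had.2.resolve_left h.2.1⟩
          ⟨⟨hbc.1, h.2.2.1⟩, hbc.2.resolve_left h.2.2.1⟩
          ⟨⟨hbd.1, h.2.2.2.1⟩, hbd.2.resolve_left h.2.2.2.1⟩
          ⟨⟨hcd.1, h.2.2.2.2⟩, hcd.2.resolve_left h.2.2.2.2⟩ hab
        exact ⟨h'.1.1, .inr h'.2⟩
    · intro h0 s hs
      rw [SimpleGraph.isNClique_iff, SimpleGraph.isClique_iff] at hs
      by_cases hex : ∃ a ∈ s, ∃ b ∈ s, a ≠ b ∧ a ∈ K ∧ b ∈ K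
      · obtain ⟨a, ha, b, hb, hab, haK, hbK⟩ := hex
        have hsub : s ⊆ K := by
          intro c hc
          by_cases hca : a = c
          · rwa [← hca]
          by_cases hcb : b = c
          · rwa [← hcb]
          exact hcl a haK b hbK hab c ((hH _ _).1 (hs.1 ha hc hca)).1 ((hH _ _).1 (hs.1 hb hc hcb)).1
        have := Finset.card_le_card hsub
        have := ht h0
        omega
      · push Not at hex
        refine h2 h0 s ?_
        rw [SimpleGraph.isNClique_iff, SimpleGraph.isClique_iff]
        refine ⟨fun a ha b hb hab => ?_, hs.2⟩
        have h3 := (hH _ _).1 (hs.1 ha hb hab)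
        have h4 := hex a ha b hb hab
        simp only [SimpleGraph.deleteEdges_adj, hG₁, Finset.mem_coe]
        tauto

/-- An edge that lies in many diamonds which pairwise share no other edge belongs to every
solution. -/
theorem yes_forcedEdge {t k : ℕ} {G G₁ : SimpleGraph V} {q w : V} {C : Finset V}
    (hqw : G.Adj q w) (hC : ∀ a ∈ C, G.Adj q a ∧ G.Adj w a) (hk : 1 ≤ k)
    (h : ∃ A ⊆ C, k < A.card ∧ ∀ a ∈ A, ∃ B ⊆ C, k < B.card ∧ ∀ b ∈ B, b ≠ a ∧ ¬ G.Adj a b)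
    (hG₁ : ∀ a b, G₁.Adj a b ↔ G.Adj a b ∧ s(a, b) ≠ s(q, w)) :
    Yes t G k ↔ Yes t G₁ (k - 1) := by
  classical
  constructor
  · rintro ⟨S, hS, h1, h2⟩
    have hmem : s(q, w) ∈ S := by
      by_contra hn
      -- Each vertex of `Z` accounts for a pair of `S` of its own, so `Z` has at most `k` elements.
      -- Hence some `a` in `A`, and then some `b` in its set `B`, avoid `Z`, and they are the tips
      -- of an intact diamond with diagonal `qw`.
      set Z := C.filter (fun z => s(q, z) ∈ S ∨ s(w, z) ∈ S) with hZ
      have hZc : Z.card ≤ k := by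
        refine le_trans (Finset.card_le_card_of_injOn
          (fun z => if s(q, z) ∈ S then s(q, z) else s(w, z)) ?_ ?_) hS
        · intro z hz
          simp only [hZ, Finset.coe_filter, Set.mem_ofPred_eq] at hz
          dsimp only
          split_ifs with h'
          · exact h'
          · tauto
        · intro z hz z' hz' e
          simp only [hZ, Finset.coe_filter, Set.mem_ofPred_eq] at hz hz'
          have a1 := (hC z hz.1).1.ne
          have a2 := (hC z hz.1).2.ne
          have a3 := (hC z' hz'.1).1.ne
          have a4 := (hC z' hz'.1).2.ne
          dsimp only at e
          split_ifs at e <;> simp only [Sym2.eq_iff] at e <;> grind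
      obtain ⟨A, hAC, hA, hAB⟩ := h
      obtain ⟨a, ha, haZ⟩ := Finset.exists_mem_notMem_of_card_lt_card (hZc.trans_lt hA)
      obtain ⟨B, hBC, hB, hBa⟩ := hAB a ha
      obtain ⟨b, hb, hbZ⟩ := Finset.exists_mem_notMem_of_card_lt_card (hZc.trans_lt hB)
      have e1 := hC a (hAC ha)
      have e2 := hC b (hBC hb)
      simp only [hZ, Finset.mem_filter, hAC ha, hBC hb, true_and, not_or] at haZ hbZ
      have := h1 a b q w
      simp only [SimpleGraph.deleteEdges_adj, Finset.mem_coe] at this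
      refine (hBa b hb).2 (this ⟨e1.1.symm, ?_⟩ ⟨e1.2.symm, ?_⟩ ⟨e2.1.symm, ?_⟩ ⟨e2.2.symm, ?_⟩
        ⟨hqw, hn⟩ (hBa b hb).1.symm).1
      · rw [Sym2.eq_swap]; exact haZ.1
      · rw [Sym2.eq_swap]; exact haZ.2
      · rw [Sym2.eq_swap]; exact hbZ.1
      · rw [Sym2.eq_swap]; exact hbZ.2
    refine ⟨S.erase s(q, w), by rw [Finset.card_erase_of_mem hmem]; omega, ?_⟩
    have hf : FreeOf t (G.deleteEdges (S : Set (Sym2 V))) := ⟨h1, h2⟩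
    convert hf using 1
    ext a b
    simp only [SimpleGraph.deleteEdges_adj, hG₁, Finset.mem_coe, Finset.mem_erase]
    by_cases e : s(a, b) = s(q, w)
    · rw [e]; tauto
    · tauto
  · rintro ⟨S, hS, hf⟩
    refine ⟨insert s(q, w) S, (Finset.card_insert_le _ _).trans (by omega), ?_⟩
    convert hf using 1
    ext a b
    simp only [SimpleGraph.deleteEdges_adj, hG₁, Finset.mem_coe, Finset.mem_insert]
    tauto

/-- A vertex `q` can be detached from a clique `K` that is too big to be touched by a solution
if no triangle with an edge between `q` and `K` leaves `K`. -/
theorem yes_detach {k : ℕ} {G G₁ : SimpleGraph V} {q : V} {K : Finset V} (hq : q ∈ K)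
    (hK : ∀ a ∈ K, ∀ b ∈ K, a ≠ b → G.Adj a b)
    (hcl : ∀ v ∈ K, v ≠ q → ∀ c, G.Adj q c → G.Adj v c → c ∈ K)
    (hcard : 2 * k + 3 ≤ K.card)
    (hout : ∀ v, v ∉ K → ∃ y ∈ K, y ≠ q ∧ ¬ G.Adj v y)
    (hG₁ : ∀ a b, G₁.Adj a b ↔ G.Adj a b ∧ ¬ (a = q ∧ b ∈ K) ∧ ¬ (b = q ∧ a ∈ K)) :
    Yes 0 G k ↔ Yes 0 G₁ k := by
  classical
  constructor
  · rintro ⟨S, hS, h1, -⟩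
    refine ⟨S, hS, ?_, fun h => absurd rfl h⟩
    intro a b c d
    have := h1 a b c d
    simp only [SimpleGraph.deleteEdges_adj, hG₁] at *
    intro hac had hbc hbd hcd hab
    have hadj := this ⟨hac.1.1, hac.2⟩ ⟨had.1.1, had.2⟩ ⟨hbc.1.1, hbc.2⟩ ⟨hbd.1.1, hbd.2⟩
        ⟨hcd.1.1, hcd.2⟩ hab
    refine ⟨⟨hadj.1, ?_, ?_⟩, hadj.2⟩
    · rintro ⟨rfl, hb⟩
      exact hac.1.2.1 ⟨rfl, hcl b hb hab.symm c hac.1.1 hbc.1.1⟩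
    · rintro ⟨rfl, ha⟩
      exact hbc.1.2.1 ⟨rfl, hcl a ha hab c hbc.1.1 hac.1.1⟩
  · rintro ⟨S₀, hS₀, hf⟩
    -- Discarding non-edges of `G₁` ensures that no pair joining `q` to `K` is deleted from `G`.
    obtain ⟨S, hS, hSG, h1⟩ : ∃ S : Finset (Sym2 V), S.card ≤ k ∧
        (∀ a b, s(a, b) ∈ S → G₁.Adj a b) ∧ FreeOf 0 (G₁.deleteEdges (S : Set (Sym2 V))) := by
      refine ⟨S₀.filter (· ∈ G₁.edgeSet), (Finset.card_filter_le _ _).trans hS₀, ?_, ?_⟩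
      · intro a b h
        simpa using (Finset.mem_filter.1 h).2
      · convert hf using 1
        ext a b
        simp only [SimpleGraph.deleteEdges_adj, Finset.coe_filter, Set.mem_ofPred_eq,
          SimpleGraph.mem_edgeSet, Finset.mem_coe]
        tauto
    replace h1 := h1.1
    simp only [SimpleGraph.deleteEdges_adj, Finset.mem_coe, hG₁] at h1
    have hsw : ∀ {a b}, s(a, b) ∉ S → s(b, a) ∉ S := fun h h' => h (by rwa [Sym2.eq_swap])
    -- the clique is untouched
    have hun : ∀ u ∈ K, ∀ v ∈ K, u ≠ v → s(u, v) ∉ S := by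
      intro u hu v hv huv huvS
      have hadj := (hG₁ _ _).1 (hSG _ _ huvS)
      have huq : u ≠ q := fun h => hadj.2.1 ⟨h, hv⟩
      have hvq : v ≠ q := fun h => hadj.2.2 ⟨h, hu⟩
      -- At least `2k + 2` vertices remain without `q` and at most `2k` of them are ends. Two
      -- vertices that are not ends form a diamond with tips `u`, `v`.
      have hc : 1 < ((K.erase q) \ ends S).card := by
        have e1 := Finset.le_card_sdiff (ends S) (K.erase q)
        have e2 := Finset.card_erase_of_mem hq
        have e3 := card_ends_le S
        omega
      obtain ⟨z, hz, z', hz', hzz⟩ := Finset.one_lt_card.1 hc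
      simp only [Finset.mem_sdiff, Finset.mem_erase] at hz hz'
      have hne : ∀ y x, y ∉ ends S → s(x, y) ∉ S := fun y x h h' => h (mem_ends_right h')
      have hne' : ∀ y x, y ∉ ends S → s(y, x) ∉ S := fun y x h h' => h (mem_ends_left h')
      have hu' := mem_ends_left huvS
      have hv' := mem_ends_right huvS
      have uz : u ≠ z := fun h => hz.2 (h ▸ hu')
      have uz' : u ≠ z' := fun h => hz'.2 (h ▸ hu')
      have vz : v ≠ z := fun h => hz.2 (h ▸ hv')
      have vz' : v ≠ z' := fun h => hz'.2 (h ▸ hv')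
      refine (h1 u v z z' ⟨⟨hK _ hu _ hz.1.2 uz, by tauto⟩, hne _ _ hz.2⟩
        ⟨⟨hK _ hu _ hz'.1.2 uz', by tauto⟩, hne _ _ hz'.2⟩
        ⟨⟨hK _ hv _ hz.1.2 vz, by tauto⟩, hne _ _ hz.2⟩
        ⟨⟨hK _ hv _ hz'.1.2 vz', by tauto⟩, hne _ _ hz'.2⟩
        ⟨⟨hK _ hz.1.2 _ hz'.1.2 hzz, by tauto⟩, hne _ _ hz'.2⟩ huv).2 huvS
    -- After the deletion no triangle on an edge of `K` leaves `K`: for edges at `q` by hypothesis,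
    -- and otherwise because an outside vertex `b` and a non-neighbour `y ≠ q` of it in `K` would be
    -- the tips of a diamond.
    have hclH : ∀ c ∈ K, ∀ d ∈ K, c ≠ d → ∀ b, G.Adj b c → s(b, c) ∉ S → G.Adj b d →
        s(b, d) ∉ S → b ∈ K := by
      intro c hc d hd hcd b hbc hbc' hbd hbd'
      by_cases h : c = q
      · subst h; exact hcl d hd hcd.symm b hbc.symm hbd.symm
      by_cases h' : d = q
      · subst h'; exact hcl c hc hcd b hbd.symm hbc.symm
      by_contra hb
      obtain ⟨y, hy, hyq, hby⟩ := hout b hb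
      have hbq : b ≠ q := fun h => hb (h ▸ hq)
      have yc : y ≠ c := fun h => hby (h ▸ hbc)
      have yd : y ≠ d := fun h => hby (h ▸ hbd)
      exact hby (h1 b y c d ⟨⟨hbc, by tauto⟩, hbc'⟩ ⟨⟨hbd, by tauto⟩, hbd'⟩
        ⟨⟨hK _ hy _ hc yc, by tauto⟩, hun _ hy _ hc yc⟩
        ⟨⟨hK _ hy _ hd yd, by tauto⟩, hun _ hy _ hd yd⟩
        ⟨⟨hK _ hc _ hd hcd, by tauto⟩, hun _ hc _ hd hcd⟩ (fun h => hb (h ▸ hy))).1.1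
    refine ⟨S, hS, ?_, fun h => absurd rfl h⟩
    intro a b c d
    simp only [SimpleGraph.deleteEdges_adj, Finset.mem_coe]
    intro hac had hbc hbd hcd hab
    have sy : ∀ {x y}, G.Adj x y ∧ s(x, y) ∉ S → G.Adj y x ∧ s(y, x) ∉ S :=
      fun h => ⟨h.1.symm, hsw h.2⟩
    have tri : ∀ {x y z}, G.Adj x y ∧ s(x, y) ∉ S → G.Adj x z ∧ s(x, z) ∉ S →
        G.Adj y z ∧ s(y, z) ∉ S → y ∈ K → z ∈ K → x ∈ K :=
      fun h h' h'' hy hz => hclH _ hy _ hz h''.1.ne _ h.1 h.2 h'.1 h'.2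
    rcases diamond_subset_or (R := fun x y => G.Adj x y ∧ s(x, y) ∉ S) (K := K) sy
      (fun x y z => tri) hac had hbc hbd hcd with h | h
    · exact ⟨hK _ h.1 _ h.2 hab, hun _ h.1 _ h.2 hab⟩
    · have aux : ∀ x y, ¬ (x ∈ K ∧ y ∈ K) → ¬ (x = q ∧ y ∈ K) ∧ ¬ (y = q ∧ x ∈ K) := by
        intro x y hxy
        constructor
        · rintro ⟨rfl, h⟩; exact hxy ⟨hq, h⟩
        · rintro ⟨rfl, h⟩; exact hxy ⟨h, hq⟩
      have := h1 a b c d ⟨⟨hac.1, aux _ _ h.1⟩, hac.2⟩ ⟨⟨had.1, aux _ _ h.2.1⟩, had.2⟩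
        ⟨⟨hbc.1, aux _ _ h.2.2.1⟩, hbc.2⟩ ⟨⟨hbd.1, aux _ _ h.2.2.2.1⟩, hbd.2⟩
        ⟨⟨hcd.1, aux _ _ h.2.2.2.2⟩, hcd.2⟩ hab
      exact ⟨this.1.1, this.2⟩

/-! ### Applicability of the rules to an edge -/

/-- `a` is `q`, `w`, or a common neighbour of them. -/
def InHull (G : SimpleGraph V) (q w a : V) : Prop := a = q ∨ a = w ∨ (G.Adj q a ∧ G.Adj w a)

open Classical in
/-- The closed clique rule applies to the edge `qw`. -/
def ClosedRule (t : ℕ) (U : Finset V) (G : SimpleGraph V) (q w : V) : Prop :=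
  G.Adj q w ∧
  (∀ a ∈ U, ∀ b ∈ U, InHull G q w a → InHull G q w b → a ≠ b → G.Adj a b) ∧
  (∀ a ∈ U, ∀ b ∈ U, ∀ c ∈ U, InHull G q w a → InHull G q w b → a ≠ b → G.Adj a c → G.Adj b c →
    InHull G q w c) ∧
  (t ≠ 0 → (U.filter (InHull G q w)).card < t)

open Classical in
/-- The forced edge rule applies to the edge `qw`. -/
def ForcedRule (U : Finset V) (G : SimpleGraph V) (k : ℕ) (q w : V) : Prop :=
  G.Adj q w ∧ 1 ≤ k ∧
  k < (U.filter fun a => (G.Adj q a ∧ G.Adj w a) ∧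
    k < (U.filter fun b => (G.Adj q b ∧ G.Adj w b) ∧ b ≠ a ∧ ¬ G.Adj a b).card).card

open Classical in
/-- The detaching rule applies to `q` and the clique spanned by the edge `qw`. -/
def DetachRule (U : Finset V) (G : SimpleGraph V) (k : ℕ) (q w : V) : Prop :=
  G.Adj q w ∧
  (∀ a ∈ U, ∀ b ∈ U, InHull G q w a → InHull G q w b → a ≠ b → G.Adj a b) ∧
  (∀ v ∈ U, ∀ c ∈ U, InHull G q w v → v ≠ q → G.Adj q c → G.Adj v c → InHull G q w c) ∧
  2 * k + 3 ≤ (U.filter (InHull G q w)).card ∧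
  (∀ v ∈ U, ¬ InHull G q w v → ∃ y ∈ U, InHull G q w y ∧ y ≠ q ∧ ¬ G.Adj v y)

/-! ### Size of a reduced yes-instance -/

section Bound

variable {t k : ℕ} {G : SimpleGraph V} {U : Finset V} {S : Finset (Sym2 V)}

theorem FreeOf.adj_of_diamond (hf : FreeOf t (G.deleteEdges (S : Set (Sym2 V)))) {a b c d : V}
    (hac : G.Adj a c) (had : G.Adj a d) (hbc : G.Adj b c) (hbd : G.Adj b d) (hcd : G.Adj c d)
    (hab : a ≠ b) (sac : s(a, c) ∉ S) (sad : s(a, d) ∉ S) (sbc : s(b, c) ∉ S) (sbd : s(b, d) ∉ S)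
    (scd : s(c, d) ∉ S) : G.Adj a b := by
  have := hf.1 a b c d
  simp only [SimpleGraph.deleteEdges_adj, Finset.mem_coe] at this
  exact (this ⟨hac, sac⟩ ⟨had, sad⟩ ⟨hbc, sbc⟩ ⟨hbd, sbd⟩ ⟨hcd, scd⟩ hab).1

theorem notMem_of_notMem_ends_left [DecidableEq V] {a b : V} (h : a ∉ ends S) : s(a, b) ∉ S :=
  fun h' => h (mem_ends_left h')

theorem notMem_of_notMem_ends_right [DecidableEq V] {a b : V} (h : b ∉ ends S) : s(a, b) ∉ S :=
  fun h' => h (mem_ends_right h')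

/-- A clique with at most one end of a solution is smaller than a forbidden clique. -/
theorem FreeOf.card_lt_of_clique [DecidableEq V]
    (hf : FreeOf t (G.deleteEdges (S : Set (Sym2 V)))) (ht : t ≠ 0) {K : Finset V}
    (hK : ∀ a ∈ K, ∀ b ∈ K, a ≠ b → G.Adj a b)
    (h1 : ∀ a ∈ K, ∀ b ∈ K, a ≠ b → s(a, b) ∉ S) : K.card < t := by
  by_contra hn
  obtain ⟨s, hs, hc⟩ := Finset.exists_subset_card_eq (not_lt.1 hn)
  refine hf.2 ht s ?_
  rw [SimpleGraph.isNClique_iff, SimpleGraph.isClique_iff]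
  refine ⟨fun a ha b hb hab => ?_, hc⟩
  simp only [SimpleGraph.deleteEdges_adj, Finset.mem_coe]
  exact ⟨hK a (hs ha) b (hs hb) hab, h1 a (hs ha) b (hs hb) hab⟩

/-- In a graph to which the closed clique rule does not apply, every non-isolated vertex which is
not an end of the solution is close to a pair of adjacent ends. -/
theorem exists_adj_ends [DecidableEq V]
    (hf : FreeOf t (G.deleteEdges (S : Set (Sym2 V))))
    (hcl : ∀ q w, ¬ ClosedRule t U G q w) {v w : V} (hvw : G.Adj v w) (hv : v ∉ ends S) :
    ∃ x ∈ ends S, ∃ y ∈ ends S, G.Adj x y ∧ ∃ b, b ∉ ends S ∧ G.Adj b x ∧ G.Adj b y ∧ G.Adj v x ∧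
      (v = b ∨ G.Adj v b) := by
  classical
  by_contra hcon
  -- A deleted pair forming a triangle with `v` would prove the claim with `b = v`. So the diamonds
  -- around `v` are intact, and the aim is to show that the closed clique rule applies to `vw`.
  have hno : ∀ x y, G.Adj v x → G.Adj v y → G.Adj x y → s(x, y) ∉ S := fun x y hx hy hxy hs =>
    hcon ⟨x, mem_ends_left hs, y, mem_ends_right hs, hxy, v, hv, hx, hy, hx, .inl rfl⟩
  have hl : ∀ x, s(v, x) ∉ S := fun x => notMem_of_notMem_ends_left hv
  have hr : ∀ x, s(x, v) ∉ S := fun x => notMem_of_notMem_ends_right hv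
  have hadj : ∀ a, InHull G v w a → a ≠ v → G.Adj v a := by
    rintro a (rfl | rfl | h) ha
    · exact absurd rfl ha
    · exact hvw
    · exact h.1
  have hclq : ∀ a b, InHull G v w a → InHull G v w b → a ≠ b → G.Adj a b := by
    rintro a b ha hb hab
    by_cases hav : a = v
    · subst hav; exact hadj b hb hab.symm
    by_cases hbv : b = v
    · subst hbv; exact (hadj a ha hab).symm
    rcases ha with rfl | rfl | ha
    · exact absurd rfl hav
    · rcases hb with rfl | rfl | hb
      · exact absurd rfl hbv
      · exact absurd rfl hab
      · exact hb.2
    · rcases hb with rfl | rfl | hb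
      · exact absurd rfl hbv
      · exact ha.2.symm
      · exact hf.adj_of_diamond ha.1.symm ha.2.symm hb.1.symm hb.2.symm hvw hab (hr _)
          (hno _ _ ha.1 hvw ha.2.symm) (hr _) (hno _ _ hb.1 hvw hb.2.symm) (hl _)
  have hcl1 : ∀ b c, InHull G v w b → b ≠ v → G.Adj v c → G.Adj b c → InHull G v w c := by
    intro b c hb hbv hvc hbc
    by_cases hcw : c = w
    · exact .inr (.inl hcw)
    by_cases hbw : b = w
    · subst hbw; exact .inr (.inr ⟨hvc, hbc⟩)
    have hvb := hadj b hb hbv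
    have hbw' := hclq b w hb (.inr (.inl rfl)) hbw
    exact .inr (.inr ⟨hvc, hf.adj_of_diamond hvw.symm hbw'.symm hvc.symm hbc.symm hvb
      (Ne.symm hcw) (hr _) (hno _ _ hvw hvb hbw'.symm) (hr _) (hno _ _ hvc hvb hbc.symm) (hl _)⟩)
  refine hcl v w ⟨hvw, fun a _ b _ => hclq a b, ?_, fun ht => ?_⟩
  · intro a _ b _ c _ ha hb hab hac hbc
    by_cases hav : a = v
    · subst hav; exact hcl1 b c hb hab.symm hac hbc
    by_cases hbv : b = v
    · subst hbv; exact hcl1 a c ha hab hbc hac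
    by_cases hcv : c = v
    · exact .inl hcv
    by_contra hcK
    have hva := hadj a ha hav
    have hvb := hadj b hb hbv
    have hnvc : ¬ G.Adj v c := fun h => hcK (hcl1 a c ha hav h hac)
    have hab' := hclq a b ha hb hab
    -- If `cx` were deleted, `c` and `x` would be ends. The claim then holds for the ends `x`, `y`
    -- with `b = v` if `y` is an end, and for the ends `x`, `c` with `b = y` otherwise.
    have key : ∀ x y, G.Adj v x → G.Adj v y → G.Adj x y → G.Adj x c → G.Adj y c →
        s(c, x) ∉ S := by
      intro x y hx hy hxy hxc hyc hs
      have hxe := mem_ends_right hs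
      have hce := mem_ends_left hs
      by_cases hye : y ∈ ends S
      · exact hcon ⟨x, hxe, y, hye, hxy, v, hv, hx, hy, hx, .inl rfl⟩
      · exact hcon ⟨x, hxe, c, hce, hxc, y, hye, hxy.symm, hyc, hx, .inr hy⟩
    exact hnvc (hf.adj_of_diamond hva hvb hac.symm hbc.symm hab' (Ne.symm hcv) (hl _) (hl _)
      (key a b hva hvb hab' hac hbc) (key b a hvb hva hab'.symm hbc hac)
      (hno a b hva hvb hab'))
  · refine hf.card_lt_of_clique ht ?_ ?_
    · intro a ha b hb hab
      exact hclq a b (Finset.mem_filter.1 ha).2 (Finset.mem_filter.1 hb).2 hab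
    · intro a ha b hb hab
      have ha' := (Finset.mem_filter.1 ha).2
      have hb' := (Finset.mem_filter.1 hb).2
      by_cases hav : a = v
      · subst hav; exact hl _
      by_cases hbv : b = v
      · subst hbv; exact hr _
      exact hno a b (hadj a ha' hav) (hadj b hb' hbv) (hclq a b ha' hb' hab)

open Classical in
/-- The vertices other than ends of the solution in the closed neighbourhood of `r` and in the
neighbourhood of `x`. -/
noncomputable def petal (G : SimpleGraph V) (U : Finset V) (S : Finset (Sym2 V)) (x r : V) :
    Finset V :=
  U.filter fun v => v ∉ ends S ∧ G.Adj v x ∧ (v = r ∨ G.Adj v r)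

/-- Petals are cliques: `u` and `v` are tips over the diagonal `xr`, and each of the five pairs
involved contains one of the non-ends `u`, `v`, `r`, so none is deleted. -/
theorem petal_adj (hf : FreeOf t (G.deleteEdges (S : Set (Sym2 V)))) {x r u v : V}
    [DecidableEq V] (hr : r ∉ ends S) (hrx : G.Adj r x) (hu : u ∉ ends S) (hux : G.Adj u x)
    (hur : u = r ∨ G.Adj u r) (hv : v ∉ ends S) (hvx : G.Adj v x) (hvr : v = r ∨ G.Adj v r)
    (huv : u ≠ v) : G.Adj u v := by
  rcases hur with rfl | hur
  · rcases hvr with rfl | hvr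
    · exact absurd rfl huv
    · exact hvr.symm
  · rcases hvr with rfl | hvr
    · exact hur
    · exact hf.adj_of_diamond hux hur hvx hvr hrx.symm huv (notMem_of_notMem_ends_left hu)
        (notMem_of_notMem_ends_left hu) (notMem_of_notMem_ends_left hv)
        (notMem_of_notMem_ends_left hv) (notMem_of_notMem_ends_right hr)

open Classical in
/-- The petals around a pair of adjacent ends are covered by few petals. -/
theorem exists_petal_cover (hU : ∀ a b, G.Adj a b → a ∈ U) (hS : S.card ≤ k)
    (hf : FreeOf t (G.deleteEdges (S : Set (Sym2 V))))
    (hfo : ∀ q w, ¬ ForcedRule U G k q w) (x y : V) (hxy : G.Adj x y) :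
    ∃ R : Finset V, R.card ≤ 1 + (if s(x, y) ∈ S then k else 0) ∧
      (∀ r ∈ R, r ∉ ends S ∧ G.Adj r x) ∧
      ∀ b, b ∉ ends S → G.Adj b x → G.Adj b y → petal G U S x b ⊆ R.biUnion (petal G U S x) := by
  set N := U.filter fun v => v ∉ ends S ∧ G.Adj v x ∧ G.Adj v y with hN
  have hfin : (N.powerset.filter fun R => ∀ a ∈ R, ∀ b ∈ R, a ≠ b → ¬ G.Adj a b).Nonempty :=
    ⟨∅, by simp⟩
  -- `R` is a maximum independent set in `N`, so each `b` in `N` equals or is adjacent to some `r`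
  -- in `R`. Then `r` lies in the petal of `b`, which is a clique and therefore contained in the
  -- petal of `r`.
  obtain ⟨R, hR, hmax⟩ := Finset.exists_max_image _ Finset.card hfin
  simp only [Finset.mem_filter, Finset.mem_powerset] at hR hmax
  have hRN : ∀ r ∈ R, r ∉ ends S ∧ G.Adj r x ∧ G.Adj r y := fun r hr => by
    have := hR.1 hr
    simp only [hN, Finset.mem_filter] at this
    exact this.2
  refine ⟨R, ?_, fun r hr => ⟨(hRN r hr).1, (hRN r hr).2.1⟩, ?_⟩
  · split_ifs with hs
    -- With `k + 2` or more members, `R` would trigger the forced edge rule: every member has at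
    -- least `k + 1` non-neighbours among the others.
    · by_contra hcard
      refine hfo x y ⟨hxy, (Finset.card_pos.2 ⟨_, hs⟩).trans_le hS, ?_⟩
      have h1 : ∀ a ∈ R, k < (U.filter fun b => (G.Adj x b ∧ G.Adj y b) ∧ b ≠ a ∧
          ¬ G.Adj a b).card := by
        intro a ha
        have : k < (R.erase a).card := by rw [Finset.card_erase_of_mem ha]; omega
        refine this.trans_le (Finset.card_le_card fun b hb => ?_)
        simp only [Finset.mem_erase] at hb
        have := hRN b hb.2
        simp only [Finset.mem_filter]
        exact ⟨hU _ _ this.2.1, ⟨this.2.1.symm, this.2.2.symm⟩, hb.1,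
          hR.2 a ha b hb.2 hb.1.symm⟩
      refine lt_of_lt_of_le (by omega : k < R.card) (Finset.card_le_card fun a ha => ?_)
      have := hRN a ha
      simp only [Finset.mem_filter]
      exact ⟨hU _ _ this.2.1, ⟨this.2.1.symm, this.2.2.symm⟩, by simpa using h1 a ha⟩
    · rw [Nat.add_zero, Finset.card_le_one]
      intro a ha b hb
      by_contra hab
      have h1 := hRN a ha
      have h2 := hRN b hb
      exact hR.2 a ha b hb hab (hf.adj_of_diamond h1.2.1 h1.2.2 h2.2.1 h2.2.2 hxy hab
        (notMem_of_notMem_ends_left h1.1) (notMem_of_notMem_ends_left h1.1)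
        (notMem_of_notMem_ends_left h2.1) (notMem_of_notMem_ends_left h2.1) hs)
  · intro b hb hbx hby
    have hbr : ∃ r ∈ R, b = r ∨ G.Adj b r := by
      by_contra hn
      push Not at hn
      have hbR : b ∉ R := fun h => (hn b h).1 rfl
      have := hmax (insert b R) ⟨?_, ?_⟩
      · rw [Finset.card_insert_of_notMem hbR] at this
        omega
      · refine Finset.insert_subset ?_ hR.1
        simp only [hN, Finset.mem_filter]
        exact ⟨hU _ _ hbx, hb, hbx, hby⟩
      · intro a ha c hc hac
        rcases Finset.mem_insert.1 ha with rfl | ha'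
        · rcases Finset.mem_insert.1 hc with rfl | hc'
          · exact absurd rfl hac
          · exact (hn c hc').2
        · rcases Finset.mem_insert.1 hc with rfl | hc'
          · exact fun h => (hn a ha').2 h.symm
          · exact hR.2 a ha' c hc' hac
    obtain ⟨r, hr, hbr⟩ := hbr
    intro v hv
    simp only [petal, Finset.mem_filter] at hv
    simp only [Finset.mem_biUnion, petal, Finset.mem_filter]
    refine ⟨r, hr, hv.1, hv.2.1, hv.2.2.1, ?_⟩
    by_cases hvr : v = r
    · exact .inl hvr
    · have h1 := hRN r hr
      refine .inr (petal_adj hf hb hbx hv.2.1 hv.2.2.1 hv.2.2.2 h1.1 h1.2.1 ?_ hvr)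
      rcases hbr with h | h
      · exact .inl h.symm
      · exact .inr h.symm

open Classical in
/-- The number of non-isolated vertices of a yes-instance to which neither the closed clique rule
nor the forced edge rule applies. -/
theorem card_nonisolated_le (hU : ∀ a b, G.Adj a b → a ∈ U) (hS : S.card ≤ k)
    (hf : FreeOf t (G.deleteEdges (S : Set (Sym2 V))))
    (hcl : ∀ q w, ¬ ClosedRule t U G q w) (hfo : ∀ q w, ¬ ForcedRule U G k q w) (z : ℕ)
    (hz : ∀ x r, r ∉ ends S → G.Adj r x → (petal G U S x r).card ≤ z) :
    (U.filter fun v => ∃ u, G.Adj v u).card ≤ 2 * k + 8 * k ^ 2 * z := by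
  have hex : ∀ p : V × V, ∃ R : Finset V, R.card ≤ 1 + (if s(p.1, p.2) ∈ S then k else 0) ∧
      (∀ r ∈ R, r ∉ ends S ∧ G.Adj r p.1) ∧ (G.Adj p.1 p.2 →
      ∀ b, b ∉ ends S → G.Adj b p.1 → G.Adj b p.2 →
        petal G U S p.1 b ⊆ R.biUnion (petal G U S p.1)) := by
    rintro ⟨x, y⟩
    by_cases hxy : G.Adj x y
    · obtain ⟨R, h1, h2, h3⟩ := exists_petal_cover hU hS hf hfo x y hxy
      exact ⟨R, h1, h2, fun _ => h3⟩
    · exact ⟨∅, by simp, by simp, fun h => absurd h hxy⟩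
  choose R hR1 hR2 hR3 using hex
  have hX : (ends S).card ≤ 2 * k := (card_ends_le S).trans (by omega)
  have hsub : (U.filter fun v => ∃ u, G.Adj v u) ⊆
      ends S ∪ (ends S ×ˢ ends S).biUnion fun p => (R p).biUnion (petal G U S p.1) := by
    intro v hv
    simp only [Finset.mem_filter] at hv
    obtain ⟨hvU, w, hvw⟩ := hv
    by_cases hve : v ∈ ends S
    · exact Finset.mem_union_left _ hve
    · obtain ⟨x, hx, y, hy, hxy, b, hb, hbx, hby, hvx, hvb⟩ := exists_adj_ends hf hcl hvw hve
      refine Finset.mem_union_right _ (Finset.mem_biUnion.2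
        ⟨(x, y), Finset.mem_product.2 ⟨hx, hy⟩, hR3 (x, y) hxy b hb hbx hby ?_⟩)
      simp only [petal, Finset.mem_filter]
      exact ⟨hvU, hve, hvx, hvb⟩
  -- Each deleted pair is charged for all four ordered pairs of its ends, the diagonal ones
  -- included.
  have hpairs : ((ends S ×ˢ ends S).filter fun p => s(p.1, p.2) ∈ S).card ≤ 4 * k := by
    have : ((ends S ×ˢ ends S).filter fun p => s(p.1, p.2) ∈ S) ⊆
        S.biUnion fun e => e.toFinset ×ˢ e.toFinset := by
      rintro ⟨x, y⟩ h
      simp only [Finset.mem_filter] at h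
      exact Finset.mem_biUnion.2 ⟨_, h.2, by simp⟩
    refine (Finset.card_le_card this).trans ((Finset.card_biUnion_le_card_mul _ _ 4 ?_).trans
      (by omega))
    intro e _
    rw [Finset.card_product, Sym2.card_toFinset]
    split_ifs <;> omega
  -- One petal for each of the at most `(2k)²` ordered pairs, and `k` more for each of the at most
  -- `4k` deleted ones.
  have hsum : ∑ p ∈ ends S ×ˢ ends S, (R p).card ≤ 8 * k ^ 2 := by
    calc ∑ p ∈ ends S ×ˢ ends S, (R p).card
        ≤ ∑ p ∈ ends S ×ˢ ends S, (1 + (if s(p.1, p.2) ∈ S then k else 0)) :=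
          Finset.sum_le_sum fun p _ => hR1 p
      _ = (ends S).card * (ends S).card +
          ((ends S ×ˢ ends S).filter fun p => s(p.1, p.2) ∈ S).card * k := by
          rw [Finset.sum_add_distrib, ← Finset.sum_filter]
          simp
      _ ≤ (2 * k) * (2 * k) + (4 * k) * k := by gcongr
      _ = 8 * k ^ 2 := by ring
  calc (U.filter fun v => ∃ u, G.Adj v u).card
      ≤ (ends S).card +
        ((ends S ×ˢ ends S).biUnion fun p => (R p).biUnion (petal G U S p.1)).card :=
        (Finset.card_le_card hsub).trans (Finset.card_union_le _ _)
    _ ≤ 2 * k + ∑ p ∈ ends S ×ˢ ends S, (R p).card * z := by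
        gcongr
        refine Finset.card_biUnion_le.trans (Finset.sum_le_sum fun p _ => ?_)
        exact Finset.card_biUnion_le_card_mul _ _ _ fun r hr => hz _ _ (hR2 p r hr).1 (hR2 p r hr).2
    _ ≤ 2 * k + 8 * k ^ 2 * z := by
        rw [← Finset.sum_mul]
        gcongr

-- A petal is a clique without ends, so all its edges survive the deletion.
open Classical in
theorem petal_card_lt (hf : FreeOf t (G.deleteEdges (S : Set (Sym2 V)))) (ht : t ≠ 0) {x r : V}
    (hr : r ∉ ends S) (hrx : G.Adj r x) : (petal G U S x r).card < t := by
  refine hf.card_lt_of_clique ht ?_ ?_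
  · intro a ha b hb hab
    simp only [petal, Finset.mem_filter] at ha hb
    exact petal_adj hf hr hrx ha.2.1 ha.2.2.1 ha.2.2.2 hb.2.1 hb.2.2.1 hb.2.2.2 hab
  · intro a ha b hb hab
    simp only [petal, Finset.mem_filter] at ha
    exact notMem_of_notMem_ends_left ha.2.1

open Classical in
/-- The common neighbours of an edge outside the ends form a clique. -/
theorem common_adj (hf : FreeOf t (G.deleteEdges (S : Set (Sym2 V)))) {u v a b : V}
    (hu : u ∉ ends S) (hv : v ∉ ends S) (huv : G.Adj u v) (hau : G.Adj u a) (hav : G.Adj v a)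
    (hbu : G.Adj u b) (hbv : G.Adj v b) (hab : a ≠ b) : G.Adj a b :=
  hf.adj_of_diamond hau.symm hav.symm hbu.symm hbv.symm huv hab (notMem_of_notMem_ends_right hu)
    (notMem_of_notMem_ends_right hv) (notMem_of_notMem_ends_right hu)
    (notMem_of_notMem_ends_right hv) (notMem_of_notMem_ends_left hu)

-- A petal larger than the number of ends contains a vertex `q` without a private end, that is, one
-- seen by `q` alone within the petal. The detaching rule then applies to `q` and any second petal
-- vertex `w`.
open Classical in
theorem petal_card_le_of_not_detachRule (hU : ∀ a b, G.Adj a b → a ∈ U) (hS : S.card ≤ k)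
    (hf : FreeOf t (G.deleteEdges (S : Set (Sym2 V))))
    (hde : ∀ q w, ¬ DetachRule U G k q w) {x r : V}
    (hr : r ∉ ends S) (hrx : G.Adj r x) : (petal G U S x r).card ≤ 2 * k + 2 := by
  by_contra hcard
  set Q := petal G U S x r with hQ
  have hX : (ends S).card ≤ 2 * k := (card_ends_le S).trans (by omega)
  have hQX : ∀ a ∈ Q, a ∉ ends S := fun a ha => by
    simp only [hQ, petal, Finset.mem_filter] at ha
    exact ha.2.1
  have hQQ : ∀ a ∈ Q, ∀ b ∈ Q, a ≠ b → G.Adj a b := by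
    intro a ha b hb hab
    simp only [hQ, petal, Finset.mem_filter] at ha hb
    exact petal_adj hf hr hrx ha.2.1 ha.2.2.1 ha.2.2.2 hb.2.1 hb.2.2.1 hb.2.2.2 hab
  -- some vertex of the petal sees only ends that see another vertex of the petal
  obtain ⟨q, hq, hgood⟩ : ∃ q ∈ Q, ∀ z ∈ ends S, G.Adj z q → ∃ p ∈ Q, p ≠ q ∧ G.Adj z p := by
    by_contra hn
    push Not at hn
    choose! f hf1 hf2 hf3 using hn
    have := Finset.card_le_card_of_injOn f (s := Q) (t := ends S) hf1 (by
      intro a ha b hb hab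
      by_contra hne
      exact hf3 a ha b hb (Ne.symm hne) (hab ▸ hf2 b hb))
    omega
  obtain ⟨w, hw, hwq⟩ : ∃ w ∈ Q, w ≠ q :=
    Finset.exists_mem_ne (by omega) q
  have hqw : G.Adj q w := hQQ q hq w hw hwq.symm
  have hqX := hQX q hq
  have hwX := hQX w hw
  have hQK : ∀ p ∈ Q, InHull G q w p := by
    intro p hp
    by_cases h1 : p = q
    · exact .inl h1
    by_cases h2 : p = w
    · exact .inr (.inl h2)
    exact .inr (.inr ⟨hQQ q hq p hp (Ne.symm h1), hQQ w hw p hp (Ne.symm h2)⟩)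
  have hKadj : ∀ a, InHull G q w a → a ≠ q → G.Adj q a := by
    rintro a (rfl | rfl | h) ha
    · exact absurd rfl ha
    · exact hqw
    · exact h.1
  have hKadj' : ∀ a, InHull G q w a → a ≠ w → G.Adj w a := by
    rintro a (rfl | rfl | h) ha
    · exact hqw.symm
    · exact absurd rfl ha
    · exact h.2
  have hclq : ∀ a b, InHull G q w a → InHull G q w b → a ≠ b → G.Adj a b := by
    intro a b ha hb hab
    by_cases a1 : a = q
    · subst a1; exact hKadj b hb hab.symm
    by_cases a2 : a = w
    · subst a2; exact hKadj' b hb hab.symm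
    by_cases b1 : b = q
    · subst b1; exact (hKadj a ha hab).symm
    by_cases b2 : b = w
    · subst b2; exact (hKadj' a ha hab).symm
    exact common_adj hf hqX hwX hqw (hKadj a ha a1) (hKadj' a ha a2) (hKadj b hb b1)
      (hKadj' b hb b2) hab
  have hKof : ∀ z, z = w ∨ (G.Adj q z ∧ G.Adj w z) → InHull G q w z := fun z h => .inr h
  refine hde q w ⟨hqw, fun a _ b _ => hclq a b, ?_, ?_, ?_⟩
  · intro v _ z _ hv hvq hqz hvz
    by_cases hzw : z = w
    · exact hKof _ (.inl hzw)
    by_cases hvw : v = w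
    · subst hvw; exact hKof _ (.inr ⟨hqz, hvz⟩)
    -- For an end `z` the choice of `q` gives a second petal vertex `p` adjacent to `z`. If `p ≠ w`,
    -- then `z` and `w` are common neighbours of the edge `qp` between non-ends, hence adjacent.
    by_cases hzX : z ∈ ends S
    · obtain ⟨p, hp, hpq, hzp⟩ := hgood z hzX hqz.symm
      by_cases hpw : p = w
      · subst hpw; exact hKof _ (.inr ⟨hqz, hzp.symm⟩)
      · exact hKof _ (.inr ⟨hqz, common_adj hf hqX (hQX p hp) (hQQ q hq p hp hpq.symm)
          hqw (hQQ p hp w hw hpw) hqz hzp.symm (Ne.symm hzw)⟩)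
    · have hqv := hKadj v hv hvq
      have hwv := hKadj' v hv hvw
      exact hKof _ (.inr ⟨hqz, hf.adj_of_diamond hqw.symm hwv hqz.symm hvz.symm hqv (Ne.symm hzw)
        (notMem_of_notMem_ends_left hwX) (notMem_of_notMem_ends_left hwX)
        (notMem_of_notMem_ends_left hzX) (notMem_of_notMem_ends_left hzX)
        (notMem_of_notMem_ends_left hqX)⟩)
  · refine le_trans (by omega : 2 * k + 3 ≤ Q.card) (Finset.card_le_card fun p hp => ?_)
    refine Finset.mem_filter.2 ⟨?_, hQK p hp⟩
    simp only [hQ, petal, Finset.mem_filter] at hp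
    exact hp.1
  -- A vertex adjacent to the whole hull except `q` shares with `q` the neighbours `w` and `p`, an
  -- edge between non-ends. So it is adjacent to `q` as well and lies in the hull.
  · intro v _ hv
    by_contra hn
    push Not at hn
    have hvw : G.Adj v w := hn w (hU _ _ hqw.symm) (.inr (.inl rfl)) hwq
    obtain ⟨p, hp, hpq, hpw⟩ : ∃ p ∈ Q, p ≠ q ∧ p ≠ w := by
      have : 0 < ((Q.erase q).erase w).card := by
        rw [Finset.card_erase_of_mem (Finset.mem_erase.2 ⟨hwq, hw⟩), Finset.card_erase_of_mem hq]
        omega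
      obtain ⟨p, hp⟩ := Finset.card_pos.1 this
      simp only [Finset.mem_erase] at hp
      exact ⟨p, hp.2.2, hp.2.1, hp.1⟩
    have hqp := hQQ q hq p hp hpq.symm
    have hvp : G.Adj v p := hn p (hU _ _ hqp.symm) (hQK p hp) hpq
    have hwp := hQQ w hw p hp hpw.symm
    have hvq : v ≠ q := fun h => hv (.inl h)
    have := common_adj hf hwX (hQX p hp) hwp hvw.symm hvp.symm hqw.symm hqp.symm hvq
    exact hv (.inr (.inr ⟨this.symm, hvw.symm⟩))

end Bound

open Classical in
theorem card_nonisolated_le_of_yes_clique {t k : ℕ} {G : SimpleGraph V} {U : Finset V} (ht : t ≠ 0)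
    (hU : ∀ a b, G.Adj a b → a ∈ U) (hy : Yes t G k) (hcl : ∀ q w, ¬ ClosedRule t U G q w)
    (hfo : ∀ q w, ¬ ForcedRule U G k q w) :
    (U.filter fun v => ∃ u, G.Adj v u).card ≤ 10 * t * k ^ 2 := by
  obtain ⟨S, hS, hf⟩ := hy
  refine (card_nonisolated_le hU hS hf hcl hfo t fun x r hr hrx =>
    (petal_card_lt hf ht hr hrx).le).trans ?_
  have h1 : k ≤ k ^ 2 := Nat.le_self_pow (by norm_num) k
  have h2 : 1 * k ≤ t * k ^ 2 := Nat.mul_le_mul (by omega) h1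
  nlinarith

open Classical in
theorem card_nonisolated_le_of_yes {k : ℕ} {G : SimpleGraph V} {U : Finset V}
    (hU : ∀ a b, G.Adj a b → a ∈ U) (hy : Yes 0 G k) (hcl : ∀ q w, ¬ ClosedRule 0 U G q w)
    (hfo : ∀ q w, ¬ ForcedRule U G k q w) (hde : ∀ q w, ¬ DetachRule U G k q w) :
    (U.filter fun v => ∃ u, G.Adj v u).card ≤ 34 * k ^ 3 := by
  obtain ⟨S, hS, hf⟩ := hy
  -- The bound is `2k + 8k²(2k + 2) = 16k³ + 16k² + 2k`, whence the constant 34.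
  refine (card_nonisolated_le hU hS hf hcl hfo (2 * k + 2) fun x r hr hrx =>
    petal_card_le_of_not_detachRule hU hS hf hde hr hrx).trans ?_
  have h1 : k ≤ k ^ 3 := Nat.le_self_pow (by norm_num) k
  have h2 : k ^ 2 ≤ k ^ 3 := by
    rcases Nat.eq_zero_or_pos k with rfl | h
    · simp
    · exact Nat.pow_le_pow_right h (by norm_num)
  nlinarith

/-! ### Running programs within a time bound -/

/-- `P` started in `s` halts within `T` steps in a state satisfying `post`. -/
def Runs (T : ℕ) (P : Program) (s : State) (post : State → Prop) : Prop :=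
  ∃ c s', Exec P s c s' ∧ c ≤ T ∧ post s'

/-- Set a register. -/
def State.set (s : State) (x v : ℕ) : State := ⟨Function.update s.reg x v, s.mem⟩

/-- Set a memory cell. -/
def State.put (s : State) (a v : ℕ) : State := ⟨s.reg, Function.update s.mem a v⟩

@[simp] theorem State.set_mem (s : State) (x v : ℕ) : (s.set x v).mem = s.mem := rfl

@[simp] theorem State.put_reg (s : State) (x v : ℕ) : (s.put x v).reg = s.reg := rfl

theorem State.set_reg (s : State) (x v y : ℕ) :
    (s.set x v).reg y = if y = x then v else s.reg y := by
  simp [State.set, Function.update_apply]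

theorem Runs.mono {T T' : ℕ} {P : Program} {s : State} {p q : State → Prop} (h : Runs T P s p)
    (hT : T ≤ T') (hpq : ∀ s', p s' → q s') : Runs T' P s q := by
  obtain ⟨c, s', h1, h2, h3⟩ := h
  exact ⟨c, s', h1, h2.trans hT, hpq _ h3⟩

theorem Runs.seq {T T' : ℕ} {P Q : Program} {s : State} {p q : State → Prop} (h : Runs T P s p)
    (h' : ∀ s', p s' → Runs T' Q s' q) : Runs (T + T') (.seq P Q) s q := by
  obtain ⟨c, s', h1, h2, h3⟩ := h
  obtain ⟨c', s'', h1', h2', h3'⟩ := h' s' h3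
  exact ⟨c + c', s'', .seq h1 h1', by omega, h3'⟩

theorem runs_assign {x : ℕ} {e : Expr} {s : State} {p : State → Prop}
    (h : p (s.set x (e.eval s))) : Runs (e.cost + 1) (.assign x e) s p :=
  ⟨_, _, .assign x e s, le_rfl, h⟩

theorem runs_store {a e : Expr} {s : State} {p : State → Prop}
    (h : p (s.put (a.eval s) (e.eval s))) : Runs (a.cost + e.cost + 1) (.store a e) s p :=
  ⟨_, _, .store a e s, le_rfl, h⟩

theorem runs_ite {T : ℕ} {e : Expr} {P Q : Program} {s : State} {p : State → Prop}
    (h1 : e.eval s ≠ 0 → Runs T P s p) (h2 : e.eval s = 0 → Runs T Q s p) :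
    Runs (e.cost + 1 + T) (.ite e P Q) s p := by
  by_cases h : e.eval s = 0
  · obtain ⟨c, s', h3, h4, h5⟩ := h2 h
    exact ⟨_, s', .iteFalse h h3, by omega, h5⟩
  · obtain ⟨c, s', h3, h4, h5⟩ := h1 h
    exact ⟨_, s', .iteTrue h h3, by omega, h5⟩

/-- The index of the invariant is a measure that drops in every round, so it bounds the number of
rounds. -/
theorem runs_loop {T : ℕ} {e : Expr} {P : Program} {I : ℕ → State → Prop}
    (hstep : ∀ j s, I j s → e.eval s ≠ 0 → Runs T P s fun s' => ∃ i < j, I i s') (j : ℕ) :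
    ∀ s, I j s → Runs (j * (T + e.cost + 1) + e.cost + 1) (.loop e P) s
      fun s' => (∃ i, I i s') ∧ e.eval s' = 0 := by
  induction j using Nat.strong_induction_on with
  | _ j ih =>
    intro s hs
    by_cases h : e.eval s = 0
    · exact ⟨_, s, .loopFalse h, by omega, ⟨j, hs⟩, h⟩
    · obtain ⟨c, s', h1, h2, i, hi, h3⟩ := hstep j s hs h
      obtain ⟨c', s'', h1', h2', h3'⟩ := ih i hi s' h3
      refine ⟨_, s'', .loopTrue h h1 h1', ?_, h3'⟩
      have : (i + 1) * (T + e.cost + 1) ≤ j * (T + e.cost + 1) := Nat.mul_le_mul_right _ hi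
      rw [add_mul] at this
      omega

/-- `for x in [0, bnd): P`, where `bnd` is a register. -/
def forLoop (x bnd : ℕ) (P : Program) : Program :=
  .seq (.assign x (.const 0))
    (.loop (.sub (.reg bnd) (.reg x)) (.seq P (.assign x (.add (.reg x) (.const 1)))))

/-- Beyond its body a round pays 4 for the increment and 4 for the test; the final 6 is the
initialisation and the last test. -/
theorem runs_forLoop {x bnd B T : ℕ} {P : Program} {s : State} (I : ℕ → State → Prop)
    (h0 : I 0 (s.set x 0)) (hI : ∀ i s, I i s → s.reg x = i ∧ s.reg bnd = B)
    (hstep : ∀ i s, i < B → I i s → Runs T P s fun s' => s'.reg x = i ∧ I (i + 1) (s'.set x (i + 1))) :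
    Runs (B * (T + 8) + 6) (forLoop x bnd P) s (I B) := by
  have key := runs_loop (T := T + 4) (e := .sub (.reg bnd) (.reg x))
    (P := .seq P (.assign x (.add (.reg x) (.const 1))))
    (I := fun j s => ∃ i, i + j = B ∧ I i s) (by
      rintro j s ⟨i, hij, hi⟩ he
      have h1 := hI i s hi
      simp only [Expr.eval, h1] at he
      refine (hstep i s (by omega) hi).seq fun s' hs' => runs_assign ?_
      refine ⟨j - 1, by omega, i + 1, by omega, ?_⟩
      simpa [Expr.eval, hs'.1] using hs'.2) B _ ⟨0, by omega, h0⟩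
  have h1 : Runs 2 (.assign x (.const 0)) s (fun s' => s' = s.set x 0) := runs_assign rfl
  refine (h1.seq fun s' hs' => by subst hs'; exact key).mono ?_ ?_
  · simp only [Expr.cost]
    ring_nf
    omega
  · rintro s' ⟨⟨_, i, hi, hs'⟩, he⟩
    have h1 := hI i s' hs'
    simp only [Expr.eval, h1] at he
    have : i = B := by omega
    exact this ▸ hs'

/-- Multiply registers `x` and `y` into `d`, using `d + 1`. -/
def mulTo (d x y : ℕ) : Program :=
  .seq (.assign d (.const 0)) (forLoop (d + 1) x (.assign d (.add (.reg d) (.reg y))))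

theorem runs_mulTo {d x y N : ℕ} {s : State} (hx : x < d) (hy : y < d) (hN : s.reg x ≤ N) :
    Runs (N * 12 + 8) (mulTo d x y) s fun s' =>
      s'.reg d = s.reg x * s.reg y ∧ s'.mem = s.mem ∧ ∀ r < d, s'.reg r = s.reg r := by
  have h1 : Runs 2 (.assign d (.const 0)) s (fun s' => s' = s.set d 0) := runs_assign rfl
  refine (h1.seq (T' := s.reg x * 12 + 6) fun s' hs' => ?_).mono (by omega) fun _ h => h
  subst hs'
  refine (runs_forLoop (B := s.reg x) (T := 4) (fun i s' => s'.reg (d + 1) = i ∧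
    s'.reg d = i * s.reg y ∧ s'.mem = s.mem ∧ ∀ r < d, s'.reg r = s.reg r) ?_ ?_ ?_).mono le_rfl ?_
  · refine ⟨by simp [State.set_reg], by simp [State.set_reg], rfl, fun r hr => ?_⟩
    simp only [State.set_reg]
    split_ifs <;> first | rfl | omega
  · rintro i s' ⟨h1, -, -, h2⟩
    exact ⟨h1, h2 x hx⟩
  · rintro i s' hi ⟨h1, h2, h3, h4⟩
    refine runs_assign ⟨?_, ?_, ?_, ?_, ?_⟩
    · simp [State.set_reg, h1]
    · simp [State.set_reg]
    · simp [State.set_reg, Expr.eval, h2, h4 y hy, add_mul]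
    · simpa using h3
    · intro r hr
      rw [State.set_reg, if_neg (by omega), State.set_reg, if_neg (by omega), h4 r hr]
  · rintro s' ⟨-, h2, h3, h4⟩
    exact ⟨h2, h3, h4⟩

/-! ### A language of counting terms over a graph -/

/-- Terms over a graph with variables, adjacency tests, addition, truncated subtraction and sums
`∑ z < x, b`, where `x` is a variable. -/
inductive Tm where
  | const (c : ℕ)
  | var (x : ℕ)
  | adj (x y : ℕ)
  | add (a b : Tm)
  | sub (a b : Tm)
  | sum (z x : ℕ) (b : Tm)

namespace Tm

open Classical in
/-- The value of a term in a graph, under an assignment of values to the variables. -/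
noncomputable def eval (G : SimpleGraph ℕ) : Tm → (ℕ → ℕ) → ℕ
  | const c, _ => c
  | var x, env => env x
  | adj x y, env => if G.Adj (env x) (env y) then 1 else 0
  | add a b, env => a.eval G env + b.eval G env
  | sub a b, env => a.eval G env - b.eval G env
  | sum z x b, env => ∑ v ∈ Finset.range (env x), b.eval G (Function.update env z v)

/-- A program computing a term into register `d`, with the variable `x` in register `ρ x`. -/
def compile : Tm → (ℕ → ℕ) → ℕ → Program
  | const c, _, d => .assign d (.const c)
  | var x, ρ, d => .assign d (.reg (ρ x))
  | adj x y, ρ, d =>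
    .seq (mulTo d 0 (ρ x))
      -- Both range tests are needed: an index of size at least `n` would address the cell of
      -- another pair or scratch memory.
      (.ite (.sub (.reg 0) (.reg (ρ x)))
        (.ite (.sub (.reg 0) (.reg (ρ y))) (.assign d (.mem (.add (.reg d) (.reg (ρ y)))))
          (.assign d (.const 0)))
        (.assign d (.const 0)))
  | add a b, ρ, d =>
    .seq (a.compile ρ d) (.seq (b.compile ρ (d + 1)) (.assign d (.add (.reg d) (.reg (d + 1)))))
  | sub a b, ρ, d =>
    .seq (a.compile ρ d) (.seq (b.compile ρ (d + 1)) (.assign d (.sub (.reg d) (.reg (d + 1)))))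
  | sum z x b, ρ, d =>
    .seq (.assign d (.const 0))
      (forLoop (d + 1) (ρ x)
        (.seq (b.compile (Function.update ρ z (d + 1)) (d + 2))
          (.assign d (.add (.reg d) (.reg (d + 2))))))

end Tm

open Classical in
/-- The state holds the adjacency matrix of the graph `G` on `{0, …, n - 1}`. -/
def Stores (s : State) (n : ℕ) (G : SimpleGraph ℕ) : Prop :=
  s.reg 0 = n ∧ (∀ i < n, ∀ j < n, s.mem (i * n + j) = if G.Adj i j then 1 else 0) ∧
    ∀ i j, G.Adj i j → i < n

theorem Stores.congr {s s' : State} {n : ℕ} {G : SimpleGraph ℕ} (h : Stores s n G)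
    (h0 : s'.reg 0 = s.reg 0) (hm : ∀ a < n * n, s'.mem a = s.mem a) : Stores s' n G := by
  refine ⟨h0.trans h.1, fun i hi j hj => ?_, h.2.2⟩
  rw [hm, h.2.1 i hi j hj]
  calc i * n + j < i * n + n := by omega
    _ = (i + 1) * n := by ring
    _ ≤ n * n := Nat.mul_le_mul_right _ hi

theorem runs_binary {T T' : ℕ} {P Q : Program} {d u v : ℕ} {s : State} {e : Expr} {w : ℕ}
    (hP : Runs T P s fun s' => s'.reg d = u ∧ s'.mem = s.mem ∧ ∀ r < d, s'.reg r = s.reg r)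
    (hQ : ∀ s', s'.reg 0 = s.reg 0 → s'.mem = s.mem → (∀ r < d, s'.reg r = s.reg r) →
      Runs T' Q s' fun s'' =>
        s''.reg (d + 1) = v ∧ s''.mem = s'.mem ∧ ∀ r < d + 1, s''.reg r = s'.reg r)
    (hd : 0 < d) (he : e.cost = 3)
    (hw : ∀ s'', s''.reg d = u → s''.reg (d + 1) = v → e.eval s'' = w) :
    Runs (T + (T' + 4)) (.seq P (.seq Q (.assign d e))) s fun s' =>
      s'.reg d = w ∧ s'.mem = s.mem ∧ ∀ r < d, s'.reg r = s.reg r := by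
  refine hP.seq fun s' hs' => (hQ s' (hs'.2.2 0 hd) hs'.2.1 hs'.2.2).seq fun s'' hs'' => ?_
  rw [show 4 = e.cost + 1 by omega]
  refine runs_assign ⟨?_, ?_, ?_⟩
  · rw [State.set_reg, if_pos rfl]
    exact hw s'' ((hs''.2.2 d (by omega)).trans hs'.1) hs''.1
  · rw [State.set_mem, hs''.2.1, hs'.2.1]
  · intro r hr
    rw [State.set_reg, if_neg (by omega), hs''.2.2 r (by omega), hs'.2.2 r hr]

/-- Registers are used as a stack: code at level `d` leaves everything below `d` and the memory
alone. The range of a sum is given by a variable, whose value never exceeds `N`, so nested loops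
stay polynomial in `N` although values of terms may be larger. -/
theorem Tm.runs_compile (t : Tm) : ∃ p : Polynomial ℕ, ∀ (N n : ℕ) (G : SimpleGraph ℕ)
    (env ρ : ℕ → ℕ) (d : ℕ) (s : State), Stores s n G → n ≤ N → 0 < d →
    (∀ x, ρ x < d ∧ s.reg (ρ x) = env x ∧ env x ≤ N) →
    Runs (p.eval N) (t.compile ρ d) s fun s' =>
      s'.reg d = t.eval G env ∧ s'.mem = s.mem ∧ ∀ r < d, s'.reg r = s.reg r := by
  have hset : ∀ (s : State) (d v w : ℕ), v = w → (s.set d v).reg d = w ∧ (s.set d v).mem = s.mem ∧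
      ∀ r < d, (s.set d v).reg r = s.reg r := fun s d v w h =>
    ⟨by rw [State.set_reg, if_pos rfl, h], rfl, fun r hr => by
      rw [State.set_reg, if_neg (by omega)]⟩
  induction t with
  | const c =>
    refine ⟨2, fun N n G env ρ d s hs hn hd hρ => (runs_assign (hset _ _ _ _ rfl)).mono ?_
      fun _ h => h⟩
    simp [Expr.cost]
  | var x =>
    refine ⟨2, fun N n G env ρ d s hs hn hd hρ =>
      (runs_assign (hset _ _ _ _ (hρ x).2.1)).mono ?_ fun _ h => h⟩
    simp [Expr.cost]
  | adj x y =>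
    refine ⟨Polynomial.X * 12 + 21, fun N n G env ρ d s hs hn hd hρ => ?_⟩
    refine ((runs_mulTo hd (hρ x).1 (hs.1.trans_le hn)).seq (T' := 13) fun s' hs' => ?_).mono ?_
      fun _ h => h
    · have e0 := (hs'.2.2 0 hd).trans hs.1
      have ex := (hs'.2.2 _ (hρ x).1).trans (hρ x).2.1
      have ey := (hs'.2.2 _ (hρ y).1).trans (hρ y).2.1
      have fin : ∀ v, v = (Tm.adj x y).eval G env →
          (s'.set d v).reg d = (Tm.adj x y).eval G env ∧ (s'.set d v).mem = s.mem ∧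
            ∀ r < d, (s'.set d v).reg r = s.reg r := by
        intro v hv
        have := hset s' d v _ hv
        exact ⟨this.1, this.2.1.trans hs'.2.1, fun r hr => (this.2.2 r hr).trans (hs'.2.2 r hr)⟩
      refine runs_ite (T := 9) (fun h1 => runs_ite (T := 5) (fun h2 => runs_assign (fin _ ?_))
        fun h2 => (runs_assign (fin _ ?_)).mono (by simp [Expr.cost]) fun _ h => h)
        fun h1 => (runs_assign (fin _ ?_)).mono (by simp [Expr.cost]) fun _ h => h
      · simp only [Expr.eval, e0, ex, ey] at h1 h2 ⊢
        rw [hs'.1, hs'.2.1, hs.1, (hρ x).2.1, mul_comm, hs.2.1 _ (by omega) _ (by omega)]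
        rfl
      · simp only [Expr.eval, e0, ex, ey] at h1 h2 ⊢
        simp only [Tm.eval]
        rw [if_neg]
        intro h
        have := hs.2.2 _ _ h.symm
        omega
      · simp only [Expr.eval, e0, ex] at h1 ⊢
        simp only [Tm.eval]
        rw [if_neg]
        intro h
        have := hs.2.2 _ _ h
        omega
    · simp [add_assoc]
  | add a b iha ihb =>
    obtain ⟨p, hp⟩ := iha
    obtain ⟨p', hp'⟩ := ihb
    refine ⟨p + (p' + 4), fun N n G env ρ d s hs hn hd hρ => ?_⟩
    rw [Polynomial.eval_add, Polynomial.eval_add, Polynomial.eval_ofNat]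
    refine runs_binary (hp N n G env ρ d s hs hn hd hρ) (fun s' h0 hm hr =>
      hp' N n G env ρ (d + 1) s' (hs.congr h0 fun a _ => by rw [hm]) hn (by omega) fun x =>
        ⟨(hρ x).1.trans (by omega), (hr _ (hρ x).1).trans (hρ x).2.1, (hρ x).2.2⟩) hd rfl ?_
    intro s'' h1 h2
    simp [Expr.eval, h1, h2, Tm.eval]
  | sub a b iha ihb =>
    obtain ⟨p, hp⟩ := iha
    obtain ⟨p', hp'⟩ := ihb
    refine ⟨p + (p' + 4), fun N n G env ρ d s hs hn hd hρ => ?_⟩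
    rw [Polynomial.eval_add, Polynomial.eval_add, Polynomial.eval_ofNat]
    refine runs_binary (hp N n G env ρ d s hs hn hd hρ) (fun s' h0 hm hr =>
      hp' N n G env ρ (d + 1) s' (hs.congr h0 fun a _ => by rw [hm]) hn (by omega) fun x =>
        ⟨(hρ x).1.trans (by omega), (hr _ (hρ x).1).trans (hρ x).2.1, (hρ x).2.2⟩) hd rfl ?_
    intro s'' h1 h2
    simp [Expr.eval, h1, h2, Tm.eval]
  | sum z x b ih =>
    obtain ⟨p, hp⟩ := ih
    refine ⟨Polynomial.X * (p + 12) + 8, fun N n G env ρ d s hs hn hd hρ => ?_⟩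
    have h1 : Runs 2 (.assign d (.const 0)) s (fun s' => s' = s.set d 0) := runs_assign rfl
    refine (h1.seq (T' := env x * (p.eval N + 4 + 8) + 6) fun s' hs' => ?_).mono ?_ fun _ h => h
    · subst hs'
      refine (runs_forLoop (B := env x) (fun i s' => s'.reg (d + 1) = i ∧
        s'.reg d = ∑ v ∈ Finset.range i, b.eval G (Function.update env z v) ∧ s'.mem = s.mem ∧
        ∀ r < d, s'.reg r = s.reg r) ?_ ?_ ?_).mono le_rfl ?_
      · refine ⟨by simp [State.set_reg], by simp [State.set_reg], rfl, fun r hr => ?_⟩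
        simp only [State.set_reg]
        split_ifs <;> first | rfl | omega
      · rintro i s' ⟨h1, -, -, h2⟩
        exact ⟨h1, (h2 _ (hρ x).1).trans (hρ x).2.1⟩
      · rintro i s' hi ⟨h1, h2, h3, h4⟩
        have hb := hp N n G (Function.update env z i) (Function.update ρ z (d + 1)) (d + 2) s'
          (hs.congr (h4 0 hd) fun a _ => by rw [h3]) hn (by omega) (by
            intro y
            by_cases hy : y = z
            · subst hy
              simp only [Function.update_self]
              exact ⟨by omega, h1, hi.le.trans (hρ x).2.2⟩
            · simp only [Function.update_of_ne hy]
              exact ⟨(hρ y).1.trans (by omega), (h4 _ (hρ y).1).trans (hρ y).2.1, (hρ y).2.2⟩)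
        refine hb.seq fun s'' hs'' => runs_assign (e := .add (.reg d) (.reg (d + 2)))
          ⟨?_, ?_, ?_, ?_, ?_⟩
        · rw [State.set_reg, if_neg (by omega), hs''.2.2 _ (by omega), h1]
        · rw [State.set_reg, if_pos rfl]
        · rw [State.set_reg, if_neg (by omega), State.set_reg, if_pos rfl]
          simp only [Expr.eval]
          rw [hs''.1, hs''.2.2 _ (by omega), h2, Finset.sum_range_succ]
        · rw [State.set_mem, State.set_mem, hs''.2.1, h3]
        · intro r hr
          rw [State.set_reg, if_neg (by omega), State.set_reg, if_neg (by omega),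
            hs''.2.2 _ (by omega), h4 r hr]
      · rintro s' ⟨-, h2, h3, h4⟩
        exact ⟨h2, h3, h4⟩
    · simp only [Polynomial.eval_add, Polynomial.eval_mul, Polynomial.eval_X,
        Polynomial.eval_ofNat]
      have : env x * (p.eval N + 12) ≤ N * (p.eval N + 12) := Nat.mul_le_mul_right _ (hρ x).2.2
      rw [show p.eval N + 4 + 8 = p.eval N + 12 by omega]
      omega

/-! ### Writing a new adjacency matrix -/

/-- Run `P` for all pairs of values of the registers `8` and `9` below register `7`. -/
def grid (P : Program) : Program := forLoop 8 7 (forLoop 9 7 P)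

theorem grid_address_injective {m a b a' b' : ℕ} (hb : b < m) (hb' : b' < m)
    (h : a * m + b = a' * m + b') : a = a' ∧ b = b' := by
  have h1 : b = b' := by
    have := congrArg (· % m) h
    simpa [Nat.add_mod, Nat.mod_eq_of_lt hb, Nat.mod_eq_of_lt hb'] using this
  subst h1
  exact ⟨Nat.eq_of_mul_eq_mul_right (by omega) (by omega : a * m = a' * m), rfl⟩

theorem grid_address_lt {m a b : ℕ} (ha : a < m) (hb : b < m) : a * m + b < m * m := by
  calc a * m + b < a * m + m := by omega
    _ = (a + 1) * m := by ring
    _ ≤ m * m := Nat.mul_le_mul_right _ ha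

/-- The body may rely on the memory outside the target block being in its original state, so it can
read an old matrix while a new one is written. -/
theorem runs_grid {P : Program} {T m off N : ℕ} {val : ℕ → ℕ → ℕ} {s₀ : State}
    (hm : s₀.reg 7 = m) (hN : m ≤ N)
    (hP : ∀ a b s, a < m → b < m → s.reg 8 = a → s.reg 9 = b → (∀ r < 8, s.reg r = s₀.reg r) →
      (∀ c, c < off ∨ off + m * m ≤ c → s.mem c = s₀.mem c) →
      Runs T P s fun s' => (∀ r < 10, s'.reg r = s.reg r) ∧
        s'.mem = Function.update s.mem (off + (a * m + b)) (val a b)) :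
    Runs (N * (N * (T + 8) + 14) + 6) (grid P) s₀ fun s' =>
      (∀ r < 8, s'.reg r = s₀.reg r) ∧
      (∀ c, c < off ∨ off + m * m ≤ c → s'.mem c = s₀.mem c) ∧
      ∀ a < m, ∀ b < m, s'.mem (off + (a * m + b)) = val a b := by
  have hT : m * (m * (T + 8) + 6 + 8) + 6 ≤ N * (N * (T + 8) + 14) + 6 := by
    have : m * (m * (T + 8) + 14) ≤ N * (N * (T + 8) + 14) := by gcongr
    rw [show m * (T + 8) + 6 + 8 = m * (T + 8) + 14 by omega]
    omega
  refine (runs_forLoop (B := m) (fun i s => s.reg 8 = i ∧ (∀ r < 8, s.reg r = s₀.reg r) ∧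
    (∀ c, c < off ∨ off + m * m ≤ c → s.mem c = s₀.mem c) ∧
      ∀ a < i, ∀ b < m, s.mem (off + (a * m + b)) = val a b) ?_ ?_ ?_).mono hT ?_
  · refine ⟨by simp [State.set_reg], fun r hr => ?_, fun _ _ => rfl, fun a ha => by omega⟩
    rw [State.set_reg, if_neg (by omega)]
  · rintro i s ⟨h1, h2, -, -⟩
    exact ⟨h1, (h2 7 (by omega)).trans hm⟩
  · rintro i s hi ⟨h1, h2, h3, h4⟩
    refine (runs_forLoop (B := m) (T := T) (fun j s' => s'.reg 9 = j ∧ s'.reg 8 = i ∧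
      (∀ r < 8, s'.reg r = s₀.reg r) ∧
      (∀ c, c < off ∨ off + m * m ≤ c → s'.mem c = s₀.mem c) ∧
      (∀ a < i, ∀ b < m, s'.mem (off + (a * m + b)) = val a b) ∧
      ∀ b < j, s'.mem (off + (i * m + b)) = val i b) ?_ ?_ ?_).mono le_rfl ?_
    · refine ⟨by simp [State.set_reg], by simp [State.set_reg, h1], fun r hr => ?_, h3, h4,
        fun a ha => by omega⟩
      rw [State.set_reg, if_neg (by omega), h2 r hr]
    · rintro j s' ⟨h1, -, h2, -⟩
      exact ⟨h1, (h2 7 (by omega)).trans hm⟩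
    · rintro j s' hj ⟨k1, k2, k3, k4, k5, k6⟩
      refine (hP i j s' hi hj k2 k1 k3 k4).mono le_rfl ?_
      rintro s'' ⟨l1, l2⟩
      have hlt := grid_address_lt hi hj
      refine ⟨by rw [l1 9 (by omega), k1], by simp [State.set_reg], ?_, ?_, ?_, ?_, ?_⟩
      · rw [State.set_reg, if_neg (by omega), l1 8 (by omega), k2]
      · intro r hr
        rw [State.set_reg, if_neg (by omega), l1 r (by omega), k3 r hr]
      · intro c hc
        rw [State.set_mem, l2, Function.update_of_ne (by omega), k4 c hc]
      · intro a ha b hb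
        rw [State.set_mem, l2, Function.update_of_ne, k5 a ha b hb]
        intro h
        have := grid_address_injective hb hj (Nat.add_left_cancel h)
        omega
      · intro b hb
        rw [State.set_mem, l2]
        by_cases hbj : b = j
        · subst hbj; rw [Function.update_self]
        · rw [Function.update_of_ne (by omega), k6 b (by omega)]
    · rintro s' ⟨-, k2, k3, k4, k5, k6⟩
      refine ⟨k2, by simp [State.set_reg], fun r hr => ?_, k4, fun a ha b hb => ?_⟩
      · rw [State.set_reg, if_neg (by omega), k3 r hr]
      · rcases Nat.lt_succ_iff_lt_or_eq.1 ha with h | h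
        · exact k5 a h b hb
        · subst h; exact k6 b hb
  · rintro s' ⟨-, h⟩
    exact h

/-- The assignment of registers to variables in which the variables in `L` are their own registers
and all others are held in register `0`. -/
def regMap (L : List ℕ) (x : ℕ) : ℕ := if x ∈ L then x else 0

/-- Replace the stored matrix by the matrix of size register `7` with the entries given by the
term `φ` in the variables `8` and `9`. -/
def rebuild (φ : Tm) : Program :=
  .seq (grid (.seq (φ.compile (regMap [1, 3, 4, 8, 9]) 20) (.seq (mulTo 21 0 0)
    (.seq (mulTo 22 8 7) (.store (.add (.reg 21) (.add (.reg 22) (.reg 9))) (.reg 20))))))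
  (.seq (grid (.seq (mulTo 21 0 0) (.seq (mulTo 22 8 7)
    (.store (.add (.reg 22) (.reg 9)) (.mem (.add (.reg 21) (.add (.reg 22) (.reg 9))))))))
    (.assign 0 (.reg 7)))

theorem runs_rebuild (φ : Tm) : ∃ p : Polynomial ℕ, ∀ (N n : ℕ) (G : SimpleGraph ℕ)
    (s : State) (m : ℕ) (val : ℕ → ℕ → ℕ), Stores s n G → n ≤ N → s.reg 7 = m → m ≤ n →
    s.reg 1 ≤ N → s.reg 3 ≤ N → s.reg 4 ≤ N →
    (∀ a < m, ∀ b < m, ∀ env : ℕ → ℕ, env 0 = n → env 1 = s.reg 1 → env 3 = s.reg 3 →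
      env 4 = s.reg 4 → env 8 = a → env 9 = b → φ.eval G env = val a b) →
    Runs (p.eval N) (rebuild φ) s fun s' =>
      s'.reg 0 = m ∧ (∀ r < 8, r ≠ 0 → s'.reg r = s.reg r) ∧
      ∀ a < m, ∀ b < m, s'.mem (a * m + b) = val a b := by
  obtain ⟨p, hp⟩ := φ.runs_compile
  refine ⟨Polynomial.X * (Polynomial.X * (p + (Polynomial.X * 12 + 8 +
    (Polynomial.X * 12 + 8 + 7)) + 8) + 14) + 6 + (Polynomial.X * (Polynomial.X *
    ((Polynomial.X * 12 + 8 + (Polynomial.X * 12 + 8 + 10)) + 8) + 14) + 6 + 2), ?_⟩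
  intro N n G s m val hs hn hm hmn h1 h3 h4 hφ
  simp only [Polynomial.eval_add, Polynomial.eval_mul, Polynomial.eval_X, Polynomial.eval_ofNat]
  -- The term must see the old matrix throughout, so the new one is built from cell `n²` on and
  -- copied to cell 0 afterwards; `m ≤ n` keeps the target of the copy clear of its source.
  refine (runs_grid (off := n * n) (val := val) hm (hmn.trans hn) ?_).seq fun s' hs' =>
    (runs_grid (off := 0) (N := N) (m := m) (val := val) ?_ (hmn.trans hn) ?_).seq fun s'' hs'' =>
      runs_assign (e := .reg 7) ?_
  · intro a b u ha hb ua ub ur um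
    have u0 : u.reg 0 = n := (ur 0 (by omega)).trans hs.1
    have u7 : u.reg 7 = m := (ur 7 (by omega)).trans hm
    refine (hp N n G (fun x => u.reg (regMap [1, 3, 4, 8, 9] x)) (regMap [1, 3, 4, 8, 9]) 20 u
      (hs.congr (ur 0 (by omega)) fun c hc => um c (.inl hc)) hn (by omega) ?_).seq fun v hv => ?_
    · intro x
      refine ⟨?_, rfl, ?_⟩
      · simp only [regMap]
        split_ifs with h
        · simp only [List.mem_cons, List.not_mem_nil, or_false] at h
          omega
        · omega
      · simp only [regMap]
        split_ifs with h
        · simp only [List.mem_cons, List.not_mem_nil, or_false] at h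
          rcases h with rfl | rfl | rfl | rfl | rfl
          · rw [ur 1 (by omega)]; exact h1
          · rw [ur 3 (by omega)]; exact h3
          · rw [ur 4 (by omega)]; exact h4
          · omega
          · omega
        · omega
    · have hval : v.reg 20 = val a b := by
        rw [hv.1]
        refine hφ a ha b hb _ ?_ ?_ ?_ ?_ ?_ ?_ <;> simp only [regMap]
        · simpa using u0
        · simpa using ur 1 (by omega)
        · simpa using ur 3 (by omega)
        · simpa using ur 4 (by omega)
        · simpa using ua
        · simpa using ub
      have v0 : v.reg 0 = n := (hv.2.2 0 (by omega)).trans u0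
      refine (runs_mulTo (N := N) (by omega) (by omega) (by omega)).seq fun w hw =>
        (runs_mulTo (N := N) (by omega) (by omega) ?_).seq fun w' hw' => runs_store ?_
      · rw [hw.2.2 8 (by omega), hv.2.2 8 (by omega), ua]; omega
      · constructor
        · intro r hr
          rw [State.put_reg, hw'.2.2 r (by omega), hw.2.2 r (by omega), hv.2.2 r (by omega)]
        · have e1 : w'.reg 21 = n * n := by rw [hw'.2.2 21 (by omega), hw.1, v0]
          have e2 : w'.reg 22 = a * m := by
            rw [hw'.1, hw.2.2 8 (by omega), hw.2.2 7 (by omega), hv.2.2 8 (by omega),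
              hv.2.2 7 (by omega), ua, u7]
          have e3 : w'.reg 9 = b := by
            rw [hw'.2.2 9 (by omega), hw.2.2 9 (by omega), hv.2.2 9 (by omega), ub]
          have e4 : w'.reg 20 = val a b := by
            rw [hw'.2.2 20 (by omega), hw.2.2 20 (by omega), hval]
          simp only [State.put, Expr.eval, e1, e2, e3, e4]
          rw [hw'.2.1, hw.2.1, hv.2.1]
  · rw [hs'.1 7 (by omega), hm]
  · intro a b u ha hb ua ub ur um
    have u0 : u.reg 0 = n := ((ur 0 (by omega)).trans (hs'.1 0 (by omega))).trans hs.1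
    have u7 : u.reg 7 = m := ((ur 7 (by omega)).trans (hs'.1 7 (by omega))).trans hm
    refine (runs_mulTo (N := N) (by omega) (by omega) (by omega)).seq fun w hw =>
        (runs_mulTo (N := N) (by omega) (by omega) ?_).seq fun w' hw' => runs_store ?_
    · rw [hw.2.2 8 (by omega), ua]; omega
    · constructor
      · intro r hr
        rw [State.put_reg, hw'.2.2 r (by omega), hw.2.2 r (by omega)]
      · have e1 : w'.reg 21 = n * n := by rw [hw'.2.2 21 (by omega), hw.1, u0]
        have e2 : w'.reg 22 = a * m := by
          rw [hw'.1, hw.2.2 8 (by omega), hw.2.2 7 (by omega), ua, u7]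
        have e3 : w'.reg 9 = b := by
          rw [hw'.2.2 9 (by omega), hw.2.2 9 (by omega), ub]
        have e4 : m * m ≤ n * n := Nat.mul_le_mul hmn hmn
        simp only [State.put, Expr.eval, e1, e2, e3]
        rw [hw'.2.1, hw.2.1, um _ (.inr (by omega)), hs'.2.2 a ha b hb, Nat.zero_add]
  · have e7 : s''.reg 7 = m := by rw [hs''.1 7 (by omega), hs'.1 7 (by omega), hm]
    refine ⟨by simp [State.set_reg, Expr.eval, e7], fun r hr hr0 => ?_, fun a ha b hb => ?_⟩
    · rw [State.set_reg, if_neg hr0, hs''.1 r hr, hs'.1 r hr]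
    · rw [State.set_mem, ← hs''.2.2 a ha b hb, Nat.zero_add]

/-! ### Derived terms -/

namespace Tm

/-- Negation. -/
def not (a : Tm) : Tm := sub (const 1) a

/-- The truth value of a term. -/
def bool (a : Tm) : Tm := a.not.not

/-- Conjunction. -/
def and (a b : Tm) : Tm := (add a.not b.not).not

/-- Disjunction. -/
def or (a b : Tm) : Tm := add a b

/-- Implication. -/
def imp (a b : Tm) : Tm := a.not.or b

/-- Strict comparison. -/
def lt (a b : Tm) : Tm := sub b a

/-- Comparison. -/
def le (a b : Tm) : Tm := (sub a b).not

/-- Equality. -/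
def eq (a b : Tm) : Tm := (a.le b).and (b.le a)

/-- Existential quantification over the numbers below variable `0`. -/
def ex (z : ℕ) (b : Tm) : Tm := sum z 0 b

/-- Universal quantification over the numbers below variable `0`. -/
def all (z : ℕ) (b : Tm) : Tm := (ex z b.not).not

/-- The number of values below variable `0` for which `b` holds. -/
def count (z : ℕ) (b : Tm) : Tm := sum z 0 b.bool

variable (G : SimpleGraph ℕ) (a b : Tm) (env : ℕ → ℕ) (z : ℕ)

/-- A term is true if its value is nonzero. -/
def Sat : Prop := a.eval G env ≠ 0

@[simp] theorem eval_const (c : ℕ) : (const c).eval G env = c := rfl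

@[simp] theorem eval_var (x : ℕ) : (var x).eval G env = env x := rfl

@[simp] theorem sat_const (c : ℕ) : (const c).Sat G env ↔ c ≠ 0 := Iff.rfl

@[simp] theorem sat_adj (x y : ℕ) : (adj x y).Sat G env ↔ G.Adj (env x) (env y) := by
  simp [Sat, eval]

@[simp] theorem sat_not : a.not.Sat G env ↔ ¬ a.Sat G env := by
  simp only [Sat, not, eval]; omega

@[simp] theorem sat_and : (a.and b).Sat G env ↔ a.Sat G env ∧ b.Sat G env := by
  simp only [Sat, and, not, eval]; omega

@[simp] theorem sat_or : (a.or b).Sat G env ↔ a.Sat G env ∨ b.Sat G env := by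
  simp only [Sat, or, eval]; omega

@[simp] theorem sat_imp : (a.imp b).Sat G env ↔ (a.Sat G env → b.Sat G env) := by
  simp only [imp, sat_or, sat_not]; tauto

@[simp] theorem sat_lt : (a.lt b).Sat G env ↔ a.eval G env < b.eval G env := by
  simp only [Sat, lt, eval]; omega

@[simp] theorem sat_le : (a.le b).Sat G env ↔ a.eval G env ≤ b.eval G env := by
  simp only [Sat, le, not, eval]; omega

@[simp] theorem sat_eq : (a.eq b).Sat G env ↔ a.eval G env = b.eval G env := by
  simp only [eq, sat_and, sat_le]; omega

@[simp] theorem sat_ex :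
    (ex z b).Sat G env ↔ ∃ v < env 0, b.Sat G (Function.update env z v) := by
  simp [Sat, ex, eval, Finset.sum_eq_zero_iff]

@[simp] theorem sat_all :
    (all z b).Sat G env ↔ ∀ v < env 0, b.Sat G (Function.update env z v) := by
  simp [all]

open Classical in
theorem eval_bool : a.bool.eval G env = if a.Sat G env then 1 else 0 := by
  simp only [bool, not, eval, Sat]
  by_cases h : a.eval G env = 0 <;> simp [h]
  omega

open Classical in
@[simp] theorem eval_count : (count z b).eval G env =
    ((Finset.range (env 0)).filter fun v => b.Sat G (Function.update env z v)).card := by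
  simp only [count, eval, eval_bool, Finset.card_filter]

theorem eval_count_of {G : SimpleGraph ℕ} {b : Tm} {env : ℕ → ℕ} {z n : ℕ} {p : ℕ → Prop}
    [DecidablePred p] (h0 : env 0 = n) (h : ∀ v, b.Sat G (Function.update env z v) ↔ p v) :
    (count z b).eval G env = ((Finset.range n).filter p).card := by
  classical
  rw [eval_count, h0]
  congr 1
  exact Finset.filter_congr fun v _ => h v

end Tm

-- The numbers with no witness at or below them are exactly those below the least witness, so
-- counting them computes the least witness.
open Classical in
theorem card_filter_first {n : ℕ} {p : ℕ → Prop} (h : ∃ u < n, p u) :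
    ((Finset.range n).filter fun v => ¬ ∃ u < n, u ≤ v ∧ p u).card < n ∧
      p ((Finset.range n).filter fun v => ¬ ∃ u < n, u ≤ v ∧ p u).card := by
  have hspec := Nat.find_spec h
  have heq : ((Finset.range n).filter fun v => ¬ ∃ u < n, u ≤ v ∧ p u) =
      Finset.range (Nat.find h) := by
    ext v
    simp only [Finset.mem_filter, Finset.mem_range]
    constructor
    · rintro ⟨_, hv⟩
      by_contra hn
      exact hv ⟨_, hspec.1, not_lt.1 hn, hspec.2⟩
    · intro hv
      refine ⟨hv.trans hspec.1, ?_⟩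
      rintro ⟨u, hu, huv, hp⟩
      exact Nat.find_min h (huv.trans_lt hv) ⟨hu, hp⟩
  rw [heq, Finset.card_range]
  exact hspec

/-- Compute a term into register `r`. -/
def evalTo (r : ℕ) (t : Tm) (L : List ℕ) : Program :=
  .seq (t.compile (regMap L) 20) (.assign r (.reg 20))

theorem runs_evalTo (r : ℕ) (t : Tm) (L : List ℕ) : ∃ p : Polynomial ℕ, ∀ (N n : ℕ)
    (G : SimpleGraph ℕ) (s : State), Stores s n G → n ≤ N →
    (∀ x ∈ L, x < 20 ∧ s.reg x ≤ N) →
    Runs (p.eval N) (evalTo r t L) s fun s' =>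
      s'.reg r = t.eval G (fun x => s.reg (regMap L x)) ∧ s'.mem = s.mem ∧
        ∀ x < 20, x ≠ r → s'.reg x = s.reg x := by
  obtain ⟨p, hp⟩ := t.runs_compile
  refine ⟨p + 2, fun N n G s hs hn hL => ?_⟩
  rw [Polynomial.eval_add, Polynomial.eval_ofNat]
  refine (hp N n G (fun x => s.reg (regMap L x)) (regMap L) 20 s hs hn (by omega) ?_).seq
    fun s' hs' => runs_assign (e := .reg 20) ?_
  · intro x
    simp only [regMap]
    split_ifs with h
    · exact ⟨(hL x h).1, trivial, (hL x h).2⟩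
    · exact ⟨by omega, trivial, hs.1.trans_le hn⟩
  · refine ⟨by simp [State.set_reg, Expr.eval, hs'.1], hs'.2.1, fun x hx hxr => ?_⟩
    rw [State.set_reg, if_neg hxr, hs'.2.2 x hx]

/-! ### Kernelization by exhaustive application of a rule -/

/-- A reduction rule for edges, given by terms in which variable `0` stands for the number of
vertices, `1` for the parameter, `3` and `4` for the edge, `8` and `9` for a pair of vertices. -/
structure ReductionRule (t : ℕ) (B : ℕ → ℕ) where
  cond : Tm
  phi : Tm
  dec : Tm
  big : Tm
  Applies : ℕ → ℕ → SimpleGraph ℕ → ℕ → ℕ → Prop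
  step : ℕ → ℕ → SimpleGraph ℕ → ℕ → ℕ → SimpleGraph ℕ
  drop : ℕ → ℕ → SimpleGraph ℕ → ℕ → ℕ → ℕ
  sat_cond : ∀ n k G q w env, env 0 = n → env 1 = k → env 3 = q → env 4 = w →
    (cond.Sat G env ↔ Applies n k G q w)
  sat_phi : ∀ n k G q w a b env, env 0 = n → env 1 = k → env 3 = q → env 4 = w → env 8 = a →
    env 9 = b → (phi.Sat G env ↔ (step n k G q w).Adj a b)
  eval_dec : ∀ n k G q w env, env 0 = n → env 1 = k → env 3 = q → env 4 = w →
    dec.eval G env = drop n k G q w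
  eval_big : ∀ k G env, env 1 = k → big.eval G env = B k
  step_lt : ∀ n k G q w, (∀ i j, G.Adj i j → i < n) → Applies n k G q w → step n k G q w < G
  yes_step : ∀ n k G q w, (∀ i j, G.Adj i j → i < n) → Applies n k G q w →
    (Yes t G k ↔ Yes t (step n k G q w) (k - drop n k G q w))
  bound : ∀ n k G, (∀ i j, G.Adj i j → i < n) → (∀ q < n, ∀ w < n, ¬ Applies n k G q w) →
    Yes t G k → ∀ F : Finset ℕ, (∀ v ∈ F, ∃ u, G.Adj v u) → F.card ≤ B k

namespace ReductionRule

variable {t : ℕ} {B : ℕ → ℕ} (R : ReductionRule t B)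

/-- Some edge can be reduced. -/
def flag : Tm := .ex 3 (.ex 4 R.cond)

/-- The first end of the first edge that can be reduced. -/
def findLeft : Tm := .count 30 (.not (.ex 3 (.and (.le (.var 3) (.var 30)) (.ex 4 R.cond))))

/-- The second end of the first edge that can be reduced. -/
def findRight : Tm := .count 30 (.not (.ex 4 (.and (.le (.var 4) (.var 30)) R.cond)))

/-- One application of the rule. -/
def body : Program :=
  .seq (evalTo 3 R.findLeft [1]) (.seq (evalTo 4 R.findRight [1, 3])
    (.seq (evalTo 6 R.dec [1, 3, 4]) (.seq (rebuild R.phi.bool)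
      (.seq (.assign 1 (.sub (.reg 1) (.reg 6))) (evalTo 5 R.flag [1])))))

open Classical in
/-- The number of adjacent pairs. -/
noncomputable def _root_.EdgeDeletion.adjCount (n : ℕ) (G : SimpleGraph ℕ) : ℕ :=
  ((Finset.range n ×ˢ Finset.range n).filter fun p => G.Adj p.1 p.2).card

theorem _root_.EdgeDeletion.adjCount_le (n : ℕ) (G : SimpleGraph ℕ) : adjCount n G ≤ n * n := by
  classical
  refine (Finset.card_filter_le _ _).trans ?_
  rw [Finset.card_product, Finset.card_range]

theorem _root_.EdgeDeletion.adjCount_lt {n : ℕ} {G H : SimpleGraph ℕ}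
    (hG : ∀ i j, G.Adj i j → i < n) (h : H < G) : adjCount n H < adjCount n G := by
  classical
  refine Finset.card_lt_card ⟨fun p hp => ?_, fun hn => h.not_ge fun i j hij => ?_⟩
  · simp only [Finset.mem_filter] at hp ⊢
    exact ⟨hp.1, h.le hp.2⟩
  · have := @hn (i, j) (by simp [hG _ _ hij, hG _ _ hij.symm, hij])
    exact (Finset.mem_filter.1 this).2

/-- The invariant of the main loop, on input `(G₀, k₀)`. -/
def Inv (n k₀ : ℕ) (G₀ : SimpleGraph ℕ) (j : ℕ) (s : State) : Prop :=
  ∃ G, Stores s n G ∧ s.reg 7 = n ∧ s.reg 1 ≤ k₀ ∧ (Yes t G₀ k₀ ↔ Yes t G (s.reg 1)) ∧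
    s.reg 3 ≤ n ∧ s.reg 4 ≤ n ∧ s.reg 2 = 0 ∧
    (s.reg 5 ≠ 0 ↔ ∃ q < n, ∃ w < n, R.Applies n (s.reg 1) G q w) ∧ adjCount n G = j

theorem sat_flag {n k : ℕ} {G : SimpleGraph ℕ} {env : ℕ → ℕ} (h0 : env 0 = n) (h1 : env 1 = k) :
    R.flag.eval G env ≠ 0 ↔ ∃ q < n, ∃ w < n, R.Applies n k G q w := by
  change R.flag.Sat G env ↔ _
  simp only [flag, Tm.sat_ex]
  rw [h0]
  refine exists_congr fun q => and_congr_right fun _ => ?_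
  simp only [Function.update_of_ne (show (0 : ℕ) ≠ 3 by decide), h0]
  refine exists_congr fun w => and_congr_right fun _ => ?_
  apply R.sat_cond <;> simp [h0, h1]

theorem eval_findLeft {n k : ℕ} {G : SimpleGraph ℕ} {env : ℕ → ℕ} (h0 : env 0 = n)
    (h1 : env 1 = k) (h : ∃ q < n, ∃ w < n, R.Applies n k G q w) :
    R.findLeft.eval G env < n ∧ ∃ w < n, R.Applies n k G (R.findLeft.eval G env) w := by
  classical
  have := card_filter_first h
  have e : R.findLeft.eval G env = ((Finset.range n).filter fun v => ¬ ∃ u < n, u ≤ v ∧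
      ∃ w < n, R.Applies n k G u w).card := by
    simp only [findLeft, Tm.eval_count, Tm.sat_not, Tm.sat_ex, Tm.sat_and, Tm.sat_le, Tm.eval_var,
      h0]
    congr 1
    refine Finset.filter_congr fun v _ => not_congr ?_
    rw [Function.update_of_ne (by decide), h0]
    refine exists_congr fun u => and_congr_right fun _ => and_congr (by simp) ?_
    rw [Function.update_of_ne (by decide), Function.update_of_ne (by decide), h0]
    refine exists_congr fun w => and_congr_right fun _ => ?_
    apply R.sat_cond <;> simp [h0, h1]
  rw [e]
  convert this

theorem eval_findRight {n k q : ℕ} {G : SimpleGraph ℕ} {env : ℕ → ℕ} (h0 : env 0 = n)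
    (h1 : env 1 = k) (h3 : env 3 = q) (h : ∃ w < n, R.Applies n k G q w) :
    R.findRight.eval G env < n ∧ R.Applies n k G q (R.findRight.eval G env) := by
  classical
  have := card_filter_first h
  have e : R.findRight.eval G env = ((Finset.range n).filter fun v => ¬ ∃ u < n, u ≤ v ∧
      R.Applies n k G q u).card := by
    simp only [findRight, Tm.eval_count, Tm.sat_not, Tm.sat_ex, Tm.sat_and, Tm.sat_le, Tm.eval_var,
      h0]
    congr 1
    refine Finset.filter_congr fun v _ => not_congr ?_
    rw [Function.update_of_ne (by decide), h0]
    refine exists_congr fun u => and_congr_right fun _ => and_congr (by simp) ?_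
    apply R.sat_cond <;> simp [h0, h1, h3]
  rw [e]
  convert this

/-- Registers 3 and 4 receive the edge, 6 the drop of the parameter, 5 the flag for the next round.
The drop refers to the old graph and is computed before rebuilding, the flag to the new graph and
parameter. The number of adjacent pairs is the loop measure. -/
theorem runs_body : ∃ p : Polynomial ℕ, ∀ (N n k₀ : ℕ) (G₀ : SimpleGraph ℕ) (j : ℕ) (s : State),
    n ≤ N → k₀ ≤ N → R.Inv n k₀ G₀ j s → s.reg 5 ≠ 0 →
    Runs (p.eval N) R.body s fun s' => ∃ i < j, R.Inv n k₀ G₀ i s' := by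
  classical
  obtain ⟨p₁, hp₁⟩ := runs_evalTo 3 R.findLeft [1]
  obtain ⟨p₂, hp₂⟩ := runs_evalTo 4 R.findRight [1, 3]
  obtain ⟨p₃, hp₃⟩ := runs_evalTo 6 R.dec [1, 3, 4]
  obtain ⟨p₄, hp₄⟩ := runs_rebuild R.phi.bool
  obtain ⟨p₅, hp₅⟩ := runs_evalTo 5 R.flag [1]
  refine ⟨p₁ + (p₂ + (p₃ + (p₄ + (4 + p₅)))), ?_⟩
  rintro N n k₀ G₀ j s hn hk ⟨G, hs, h7, h1, hy, h3, h4, h2, h5, hj⟩ h5'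
  simp only [Polynomial.eval_add, Polynomial.eval_ofNat]
  have hex := h5.1 h5'
  obtain ⟨hq, hex'⟩ := R.eval_findLeft (env := fun x => s.reg (regMap [1] x))
    (by simpa [regMap] using hs.1) (by simp [regMap]) hex
  refine (hp₁ N n G s hs hn (by simpa using h1.trans hk)).seq fun s₁ hs₁ => ?_
  rw [← hs₁.1] at hq hex'
  have st₁ : Stores s₁ n G := hs.congr (hs₁.2.2 0 (by omega) (by omega)) fun _ _ => by rw [hs₁.2.1]
  have r1 : s₁.reg 1 = s.reg 1 := hs₁.2.2 1 (by omega) (by omega)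
  rw [← r1] at hex'
  obtain ⟨hw, happ⟩ := R.eval_findRight (env := fun x => s₁.reg (regMap [1, 3] x))
    (by simpa [regMap] using st₁.1) (by simp [regMap]) (by simp [regMap]) hex'
  refine (hp₂ N n G s₁ st₁ hn (by simp; omega)).seq fun s₂ hs₂ => ?_
  rw [← hs₂.1] at hw happ
  have st₂ : Stores s₂ n G := st₁.congr (hs₂.2.2 0 (by omega) (by omega)) fun _ _ => by
    rw [hs₂.2.1]
  have r1' : s₂.reg 1 = s.reg 1 := (hs₂.2.2 1 (by omega) (by omega)).trans r1
  rw [← hs₂.2.2 3 (by omega) (by omega)] at happ hq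
  rw [r1] at happ
  refine (hp₃ N n G s₂ st₂ hn (by simp; omega)).seq fun s₃ hs₃ => ?_
  have st₃ : Stores s₃ n G := st₂.congr (hs₃.2.2 0 (by omega) (by omega)) fun _ _ => by
    rw [hs₃.2.1]
  have c1 : s₃.reg 1 = s.reg 1 := (hs₃.2.2 1 (by omega) (by omega)).trans r1'
  have c3 : s₃.reg 3 = s₂.reg 3 := hs₃.2.2 3 (by omega) (by omega)
  have c4 : s₃.reg 4 = s₂.reg 4 := hs₃.2.2 4 (by omega) (by omega)
  have c7 : s₃.reg 7 = n := by
    rw [hs₃.2.2 7 (by omega) (by omega), hs₂.2.2 7 (by omega) (by omega),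
      hs₁.2.2 7 (by omega) (by omega), h7]
  have c2 : s₃.reg 2 = 0 := by
    rw [hs₃.2.2 2 (by omega) (by omega), hs₂.2.2 2 (by omega) (by omega),
      hs₁.2.2 2 (by omega) (by omega), h2]
  have c6 : s₃.reg 6 = R.drop n (s.reg 1) G (s₂.reg 3) (s₂.reg 4) := by
    rw [hs₃.1]
    apply R.eval_dec <;> simp only [regMap]
    · simpa using st₂.1
    · simpa using r1'
    · simp
    · simp
  set q := s₂.reg 3
  set w := s₂.reg 4
  set G' := R.step n (s.reg 1) G q w with hG'
  have hlt : G' < G := R.step_lt _ _ _ _ _ hs.2.2 happ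
  refine (hp₄ N n G s₃ n (fun a b => if G'.Adj a b then 1 else 0) st₃ hn c7 le_rfl (by omega)
    (by omega) (by omega) ?_).seq fun s₄ hs₄ => ?_
  · intro a _ b _ env e0 e1 e3 e4 e8 e9
    have := R.sat_phi n (s.reg 1) G q w a b env e0 (e1.trans c1) (e3.trans c3) (e4.trans c4) e8 e9
    rw [Tm.eval_bool]
    simp only [this, hG']
  have st₄ : Stores s₄ n G' := ⟨hs₄.1, hs₄.2.2, fun i j hij => hs.2.2 i j (hlt.le hij)⟩
  refine Runs.seq (T := 4) (runs_assign (e := .sub (.reg 1) (.reg 6)) (p := fun u =>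
    u = s₄.set 1 (Expr.eval s₄ (.sub (.reg 1) (.reg 6)))) rfl) ?_
  rintro s₅ hs₅
  have st₅ : Stores s₅ n G' := st₄.congr (by rw [hs₅, State.set_reg, if_neg (by omega)])
    fun _ _ => by rw [hs₅, State.set_mem]
  have d1 : s₅.reg 1 = s.reg 1 - R.drop n (s.reg 1) G q w := by
    rw [hs₅, State.set_reg, if_pos rfl]
    simp only [Expr.eval]
    rw [hs₄.2.1 1 (by omega) (by omega), hs₄.2.1 6 (by omega) (by omega), c6, c1]
  have dd : ∀ r < 8, r ≠ 0 → r ≠ 1 → s₅.reg r = s₃.reg r := fun r hr hr0 hr1 => by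
    rw [hs₅, State.set_reg, if_neg hr1, hs₄.2.1 r hr hr0]
  refine (hp₅ N n G' s₅ st₅ hn (by simp; omega)).mono le_rfl fun s₆ hs₆ => ?_
  have f : ∀ r < 8, r ≠ 5 → s₆.reg r = s₅.reg r := fun r hr hr5 => hs₆.2.2 r (by omega) hr5
  refine ⟨adjCount n G', hj ▸ adjCount_lt hs.2.2 hlt, G',
    st₅.congr (f 0 (by omega) (by omega)) fun _ _ => by rw [hs₆.2.1], ?_, ?_, ?_, ?_, ?_, ?_, ?_, rfl⟩
  · rw [f 7 (by omega) (by omega), dd 7 (by omega) (by omega) (by omega), c7]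
  · rw [f 1 (by omega) (by omega), d1]; omega
  · rw [hy, f 1 (by omega) (by omega), d1]
    exact R.yes_step _ _ _ _ _ hs.2.2 happ
  · rw [f 3 (by omega) (by omega), dd 3 (by omega) (by omega) (by omega)]; omega
  · rw [f 4 (by omega) (by omega), dd 4 (by omega) (by omega) (by omega)]; omega
  · rw [f 2 (by omega) (by omega), dd 2 (by omega) (by omega) (by omega), c2]
  · rw [hs₆.1, f 1 (by omega) (by omega)]
    exact R.sat_flag (by simpa [regMap] using st₅.1) (by simp [regMap])

/-- The number of non-isolated vertices. -/
def _root_.EdgeDeletion.Tm.nonisolated : Tm := .count 30 (.ex 31 (.adj 30 31))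

/-- The rank among the non-isolated vertices. -/
def _root_.EdgeDeletion.Tm.rank (x : ℕ) : Tm :=
  .count 30 (.and (.lt (.var 30) (.var x)) (.ex 31 (.adj 30 31)))

/-- The adjacency matrix of the graph on the non-isolated vertices. -/
def _root_.EdgeDeletion.Tm.compact : Tm :=
  .ex 20 (.ex 21 (.and (.adj 20 21) (.and (.eq (.rank 20) (.var 8)) (.eq (.rank 21) (.var 9)))))

/-- The kernelization. -/
def program : Program :=
  .seq (.assign 7 (.reg 0)) (.seq (evalTo 5 R.flag [1]) (.seq (.loop (.reg 5) R.body)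
    (.seq (evalTo 7 .nonisolated [1]) (.seq (evalTo 2 (.sub .nonisolated R.big) [1])
      (.ite (.reg 2) (.assign 2 (.const 1)) (rebuild Tm.compact.bool))))))

end ReductionRule

/-! ### Removal of isolated vertices -/

section Compact

open Classical

variable {n : ℕ} {G : SimpleGraph ℕ}

theorem card_nonisolated_eq_count (n : ℕ) (G : SimpleGraph ℕ) :
    ((Finset.range n).filter fun v => ∃ u, G.Adj v u).card =
      Nat.count (fun v => ∃ u, G.Adj v u) n := by
  rw [Nat.count_eq_card_filter_range]

theorem eval_nonisolated (hG : ∀ i j, G.Adj i j → i < n) {env : ℕ → ℕ} (h0 : env 0 = n) :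
    Tm.nonisolated.eval G env = Nat.count (fun v => ∃ u, G.Adj v u) n := by
  rw [← card_nonisolated_eq_count]
  simp only [Tm.nonisolated, Tm.eval_count, Tm.sat_ex, Tm.sat_adj, h0]
  congr 1
  refine Finset.filter_congr fun v _ => ?_
  rw [Function.update_of_ne (by decide), h0]
  refine exists_congr fun u => ?_
  simpa using fun h : G.Adj v u => hG _ _ h.symm

theorem eval_rank (hG : ∀ i j, G.Adj i j → i < n) {env : ℕ → ℕ} {x : ℕ} (hx : x < 30)
    (h0 : env 0 = n) (hn : env x ≤ n) :
    (Tm.rank x).eval G env = Nat.count (fun v => ∃ u, G.Adj v u) (env x) := by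
  rw [← card_nonisolated_eq_count]
  simp only [Tm.rank, Tm.eval_count, Tm.sat_ex, Tm.sat_adj, Tm.sat_and, Tm.sat_lt, Tm.eval_var]
  congr 1
  ext v
  have hx1 : x ≠ 30 := by omega
  simp only [Finset.mem_filter, Finset.mem_range, h0, Function.update_of_ne hx1,
    Function.update_of_ne (show (0 : ℕ) ≠ 30 by decide),
    Function.update_of_ne (show (30 : ℕ) ≠ 31 by decide), Function.update_self]
  constructor
  · rintro ⟨h1, h2, u, _, h⟩
    exact ⟨h2, u, h⟩
  · rintro ⟨h2, u, h⟩
    exact ⟨by omega, h2, u, hG _ _ h.symm, h⟩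

theorem sat_compact (hG : ∀ i j, G.Adj i j → i < n) {env : ℕ → ℕ} (h0 : env 0 = n) :
    Tm.compact.Sat G env ↔ ∃ u v, G.Adj u v ∧ Nat.count (fun v => ∃ u, G.Adj v u) u = env 8 ∧
      Nat.count (fun v => ∃ u, G.Adj v u) v = env 9 := by
  simp only [Tm.compact, Tm.sat_ex, Tm.sat_adj, Tm.sat_and, Tm.sat_eq, Tm.eval_var]
  have key : ∀ u < n, ∀ v < n, ∀ x, (x = 20 ∨ x = 21) →
      (Tm.rank x).eval G (Function.update (Function.update env 20 u) 21 v) =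
        Nat.count (fun v => ∃ u, G.Adj v u) (if x = 21 then v else u) := by
    intro u hu v hv x hx
    rw [eval_rank hG (n := n) (by omega) (by simp [h0])]
    · rcases hx with rfl | rfl <;> simp
    · rcases hx with rfl | rfl <;> simp [hu.le, hv.le]
  constructor
  · rintro ⟨u, hu, v, hv, h1, h2, h3⟩
    simp only [Function.update_apply, h0] at hu hv
    simp at hv
    rw [key u hu v (by omega) _ (by simp)] at h2 h3
    simp at h1 h2 h3
    exact ⟨u, v, h1, h2, h3⟩
  · rintro ⟨u, v, h1, h2, h3⟩
    have hu := hG _ _ h1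
    have hv := hG _ _ h1.symm
    refine ⟨u, h0 ▸ hu, v, by simpa [Function.update_apply, h0] using hv, ?_, ?_, ?_⟩
    · simpa [Function.update_apply] using h1
    · rw [key u hu v hv _ (by simp)]
      simpa [Function.update_apply] using h2
    · rw [key u hu v hv _ (by simp)]
      simpa [Function.update_apply] using h3

/-- The graph `G` is the image of a graph on as many vertices as `G` has non-isolated vertices. -/
theorem exists_compact (hG : ∀ i j, G.Adj i j → i < n) :
    ∃ (f : Fin (Nat.count (fun v => ∃ u, G.Adj v u) n) ↪ ℕ)
      (G' : SimpleGraph (Fin (Nat.count (fun v => ∃ u, G.Adj v u) n))), G'.map f = G ∧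
      ∀ i j, G'.Adj i j ↔ ∃ u v, G.Adj u v ∧ Nat.count (fun v => ∃ u, G.Adj v u) u = i ∧
        Nat.count (fun v => ∃ u, G.Adj v u) v = j := by
  set p : ℕ → Prop := fun v => ∃ u, G.Adj v u with hp
  have hfin : ∀ hf : (Set.ofPred p).Finite, hf.toFinset.card = Nat.count p n := by
    intro hf
    rw [Nat.count_eq_card_filter_range]
    congr 1
    ext v
    simp only [Set.Finite.mem_toFinset, Set.mem_ofPred_eq, Finset.mem_filter, Finset.mem_range]
    exact ⟨fun ⟨u, hu⟩ => ⟨hG _ _ hu, u, hu⟩, fun h => h.2⟩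
  have hcn : ∀ i : Fin (Nat.count p n), Nat.count p (Nat.nth p i) = i := fun i =>
    Nat.count_nth fun hf => by rw [hfin hf]; exact i.2
  -- The embedding lists the non-isolated vertices in increasing order; there `Nat.nth` and
  -- `Nat.count` invert each other.
  refine ⟨⟨fun i => Nat.nth p i, fun i j hij => Fin.ext ?_⟩,
    G.comap fun i => Nat.nth p i, ?_, ?_⟩
  · rw [← hcn i, ← hcn j]
    exact congrArg _ hij
  · ext a b
    simp only [SimpleGraph.map_adj, SimpleGraph.comap_adj]
    constructor
    · rintro ⟨i, j, h, rfl, rfl⟩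
      exact h
    · intro h
      have ha : p a := ⟨b, h⟩
      have hb : p b := ⟨a, h.symm⟩
      have ea : Nat.nth p (Nat.count p a) = a := Nat.nth_count ha
      have eb : Nat.nth p (Nat.count p b) = b := Nat.nth_count hb
      exact ⟨⟨_, Nat.count_strict_mono ha (hG _ _ h)⟩, ⟨_, Nat.count_strict_mono hb (hG _ _ h.symm)⟩,
        by rw [← ea, ← eb] at h; exact h, ea, eb⟩
  · intro i j
    simp only [SimpleGraph.comap_adj]
    constructor
    · intro h
      exact ⟨_, _, h, hcn i, hcn j⟩
    · rintro ⟨u, v, h, hu, hv⟩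
      have ea : Nat.nth p (Nat.count p u) = u := Nat.nth_count ⟨v, h⟩
      have eb : Nat.nth p (Nat.count p v) = v := Nat.nth_count ⟨u, h.symm⟩
      rw [← hu, ← hv, ea, eb]
      exact h

theorem stores_inputState (G : SimpleGraph (Fin n)) (k : ℕ) :
    Stores (inputState G k) n (G.map Fin.valEmbedding) := by
  have h := holds_inputState G k
  refine ⟨h.1, fun i hi j hj => ?_, fun i j hij => ?_⟩
  · have hadj : (G.map Fin.valEmbedding).Adj i j ↔ G.Adj ⟨i, hi⟩ ⟨j, hj⟩ :=
      SimpleGraph.map_adj_apply (f := Fin.valEmbedding) (a := ⟨i, hi⟩) (b := ⟨j, hj⟩)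
    split_ifs with hij
    · exact (h.2.2 ⟨i, hi⟩ ⟨j, hj⟩).1 (hadj.1 hij)
    · exact (h.2.2 ⟨i, hi⟩ ⟨j, hj⟩).2 (mt hadj.2 hij)
  · rw [SimpleGraph.map_adj] at hij
    obtain ⟨u, _, _, rfl, _⟩ := hij
    exact u.2

end Compact

/-! ### Correctness of the kernelization program -/

theorem ReductionRule.hasKernelization {t : ℕ} {B : ℕ → ℕ} (R : ReductionRule t B) (ht : t ≠ 1)
    (hB : Monotone B) {ℋ : GraphFamily}
    (hℋ : ∀ (n : ℕ) (G : SimpleGraph (Fin n)), IsFree ℋ G ↔ FreeOf t G) :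
    HasKernelization ℋ B := by
  classical
  obtain ⟨p₁, hp₁⟩ := runs_evalTo 5 R.flag [1]
  obtain ⟨p₂, hp₂⟩ := R.runs_body
  obtain ⟨p₃, hp₃⟩ := runs_evalTo 7 .nonisolated [1]
  obtain ⟨p₄, hp₄⟩ := runs_evalTo 2 (.sub .nonisolated R.big) [1]
  obtain ⟨p₅, hp₅⟩ := runs_rebuild Tm.compact.bool
  refine ⟨R.program, 2 + (p₁ + (Polynomial.X * Polynomial.X * (p₂ + 1 + 1) + 2 +
    (p₃ + (p₄ + (2 + (p₅ + 2)))))), fun n G₀ k₀ => ?_⟩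
  -- All reductions take place on the vertex set `ℕ`; the extra vertices are isolated and harmless.
  set G₁ := G₀.map Fin.valEmbedding with hG₁
  have st₀ : Stores (inputState G₀ k₀) n G₁ := stores_inputState G₀ k₀
  suffices h : Runs ((2 + (p₁ + (Polynomial.X * Polynomial.X * (p₂ + 1 + 1) + 2 +
    (p₃ + (p₄ + (2 + (p₅ + 2)))))) : Polynomial ℕ).eval (n + k₀)) R.program (inputState G₀ k₀)
      fun s => (s.reg 2 = 1 ∧ ¬ Yes t G₁ k₀) ∨ (s.reg 2 = 0 ∧ ∃ (n' : ℕ)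
        (G' : SimpleGraph (Fin n')) (k' : ℕ), Holds s G' k' ∧ (Yes t G₁ k₀ ↔ Yes t G' k') ∧
          n' ≤ B k₀ ∧ k' ≤ k₀) by
    obtain ⟨c, s, h1, h2, h3⟩ := h
    refine ⟨c, s, h1, h2, ?_⟩
    simpa only [isYes_iff_yes (hℋ _), hG₁, yes_map_iff ht] using h3
  set N := n + k₀ with hN
  simp only [Polynomial.eval_add, Polynomial.eval_mul, Polynomial.eval_X, Polynomial.eval_ofNat,
    Polynomial.eval_one]
  refine Runs.seq (T := 2) (runs_assign (e := .reg 0) (p := fun u =>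
    u = (inputState G₀ k₀).set 7 n) (by rw [show Expr.eval _ (.reg 0) = n from st₀.1])) ?_
  intro s₁ hs₁
  have st₁ : Stores s₁ n G₁ := st₀.congr (by rw [hs₁, State.set_reg, if_neg (by omega)])
    fun _ _ => by rw [hs₁, State.set_mem]
  have r₁ : ∀ x, x ≠ 7 → x ≠ 0 → x ≠ 1 → s₁.reg x = 0 := fun x h h0 h1 => by
    rw [hs₁, State.set_reg, if_neg h]
    simp [inputState, h0, h1]
  have r₁1 : s₁.reg 1 = k₀ := by
    rw [hs₁, State.set_reg, if_neg (by omega)]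
    simp [inputState]
  refine (hp₁ N n G₁ s₁ st₁ (by omega) (by simp [r₁1]; omega)).seq fun s₂ hs₂ => ?_
  have hinv : R.Inv n k₀ G₁ (adjCount n G₁) s₂ := by
    have e1 : s₂.reg 1 = k₀ := by rw [hs₂.2.2 1 (by omega) (by omega), r₁1]
    refine ⟨G₁, st₁.congr (hs₂.2.2 0 (by omega) (by omega)) fun _ _ => by rw [hs₂.2.1],
      ?_, e1.le, by rw [e1], ?_, ?_, ?_, ?_, rfl⟩
    · rw [hs₂.2.2 7 (by omega) (by omega), hs₁, State.set_reg, if_pos rfl]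
    · rw [hs₂.2.2 3 (by omega) (by omega), r₁ 3 (by omega) (by omega) (by omega)]; omega
    · rw [hs₂.2.2 4 (by omega) (by omega), r₁ 4 (by omega) (by omega) (by omega)]; omega
    · rw [hs₂.2.2 2 (by omega) (by omega), r₁ 2 (by omega) (by omega) (by omega)]
    · rw [hs₂.1, e1]
      exact R.sat_flag (by simpa [regMap] using st₁.1) (by simpa [regMap] using r₁1)
  -- Each round loses an edge, so this bounds the number of rounds.
  have hcount : adjCount n G₁ ≤ N * N :=
    (adjCount_le n G₁).trans (Nat.mul_le_mul (by omega) (by omega))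
  have hloop := runs_loop (e := .reg 5) (fun j s hj he => hp₂ N n k₀ G₁ j s (by omega) (by omega) hj he)
    (adjCount n G₁) s₂ hinv
  refine (hloop.mono ?_ fun _ h => h).seq fun s₃ hs₃ => ?_
  · have := Nat.mul_le_mul_right (p₂.eval N + 1 + 1) hcount
    simp only [Expr.cost]
    omega
  obtain ⟨⟨j, G, hs, h7, h1, hy, h3, h4, h2, h5, -⟩, he⟩ := hs₃
  have hred : ∀ q < n, ∀ w < n, ¬ R.Applies n (s₃.reg 1) G q w := by
    have : ¬ s₃.reg 5 ≠ 0 := not_not.2 he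
    rw [h5] at this
    push Not at this
    exact this
  set k := s₃.reg 1 with hk
  set m := Nat.count (fun v => ∃ u, G.Adj v u) n with hm
  have hmn : m ≤ n := Nat.count_le _
  refine (hp₃ N n G s₃ hs (by omega) (by simp; omega)).seq fun s₄ hs₄ => ?_
  have st₄ : Stores s₄ n G := hs.congr (hs₄.2.2 0 (by omega) (by omega)) fun _ _ => by rw [hs₄.2.1]
  have m₄ : s₄.reg 7 = m := by
    rw [hs₄.1]
    exact eval_nonisolated hs.2.2 (by simpa [regMap] using hs.1)
  have k₄ : s₄.reg 1 = k := hs₄.2.2 1 (by omega) (by omega)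
  refine (hp₄ N n G s₄ st₄ (by omega) (by simp; omega)).seq fun s₅ hs₅ => ?_
  have st₅ : Stores s₅ n G := st₄.congr (hs₅.2.2 0 (by omega) (by omega)) fun _ _ => by
    rw [hs₅.2.1]
  have c₅ : s₅.reg 2 = m - B k := by
    rw [hs₅.1]
    simp only [Tm.eval]
    rw [eval_nonisolated hs.2.2 (by simpa [regMap] using st₄.1),
      R.eval_big k G _ (by simpa [regMap] using k₄)]
  have f₅ : ∀ r < 8, r ≠ 2 → r ≠ 7 → s₅.reg r = s₃.reg r := fun r hr h h' => by
    rw [hs₅.2.2 r (by omega) h, hs₄.2.2 r (by omega) h']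
  refine (runs_ite (T := p₅.eval N + 2) (fun hne => ?_) fun heq => ?_).mono
    (by simp [Expr.cost]) fun _ h => h
  · refine (runs_assign (.inl ⟨by simp [State.set_reg, Expr.eval], fun hyes => ?_⟩)).mono
      (by simp [Expr.cost]) fun _ h => h
    have hle := R.bound n k G hs.2.2 hred (hy.1 hyes)
      ((Finset.range n).filter fun v => ∃ u, G.Adj v u) (fun v hv => (Finset.mem_filter.1 hv).2)
    rw [card_nonisolated_eq_count] at hle
    change s₅.reg 2 ≠ 0 at hne
    omega
  · change s₅.reg 2 = 0 at heq
    obtain ⟨f, G', hmap, hadj⟩ := exists_compact hs.2.2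
    refine (hp₅ N n G s₅ m (fun a b => if ∃ u v, G.Adj u v ∧
      Nat.count (fun v => ∃ u, G.Adj v u) u = a ∧ Nat.count (fun v => ∃ u, G.Adj v u) v = b
      then 1 else 0) st₅ (by omega) ?_ hmn ?_ ?_ ?_ ?_).mono (by omega) ?_
    · rw [hs₅.2.2 7 (by omega) (by omega), m₄]
    · rw [f₅ 1 (by omega) (by omega) (by omega)]; omega
    · rw [f₅ 3 (by omega) (by omega) (by omega)]; omega
    · rw [f₅ 4 (by omega) (by omega) (by omega)]; omega
    · intro a _ b _ env e0 _ _ _ e8 e9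
      rw [Tm.eval_bool]
      simp only [sat_compact hs.2.2 e0, e8, e9]
    · rintro s₆ ⟨i0, i1, i2⟩
      refine .inr ⟨by rw [i1 2 (by omega) (by omega), heq], m, G', k,
        ⟨i0, ?_, fun a b => ?_⟩, ?_, ?_, h1⟩
      · rw [i1 1 (by omega) (by omega), f₅ 1 (by omega) (by omega) (by omega)]
      · rw [i2 a a.2 b b.2, hadj]
        constructor
        · intro h; exact if_pos h
        · intro h; exact if_neg h
      · rw [hy, ← hmap, yes_map_iff ht]
      -- The size test used the current parameter; monotonicity carries the bound over to the
      -- original one.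
      · have := hB h1
        omega

/-! ### The rules as terms -/

namespace Tm

/-- Membership in the closed common neighbourhood of the edge held in variables `3` and `4`. -/
def inHull (x : ℕ) : Tm :=
  .or (.eq (.var x) (.var 3)) (.or (.eq (.var x) (.var 4)) (.and (.adj 3 x) (.adj 4 x)))

/-- The closed common neighbourhood is a clique. -/
def hullClique : Tm :=
  .all 30 (.all 31 (.imp (inHull 30) (.imp (inHull 31)
    (.imp (.not (.eq (.var 30) (.var 31))) (.adj 30 31)))))

/-- The closed clique rule. -/
def closed (t : ℕ) : Tm :=
  .and (.adj 3 4) (.and hullClique (.and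
    (.all 30 (.all 31 (.all 32 (.imp (inHull 30) (.imp (inHull 31)
      (.imp (.not (.eq (.var 30) (.var 31))) (.imp (.adj 30 32) (.imp (.adj 31 32)
        (inHull 32)))))))))
    (.imp (.const t) (.lt (.count 30 (inHull 30)) (.const t)))))

/-- The forced edge rule. -/
def forced : Tm :=
  .and (.adj 3 4) (.and (.le (.const 1) (.var 1)) (.lt (.var 1) (.count 30
    (.and (.and (.adj 3 30) (.adj 4 30)) (.lt (.var 1) (.count 31
      (.and (.and (.adj 3 31) (.adj 4 31))
        (.and (.not (.eq (.var 31) (.var 30))) (.not (.adj 30 31))))))))))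

/-- The detaching rule. -/
def detach : Tm :=
  .and (.adj 3 4) (.and hullClique (.and
    (.all 30 (.all 31 (.imp (inHull 30) (.imp (.not (.eq (.var 30) (.var 3)))
      (.imp (.adj 3 31) (.imp (.adj 30 31) (inHull 31)))))))
    (.and (.le (.add (.add (.var 1) (.var 1)) (.const 3)) (.count 30 (inHull 30)))
      (.all 30 (.imp (.not (inHull 30)) (.ex 31 (.and (inHull 31)
        (.and (.not (.eq (.var 31) (.var 3))) (.not (.adj 30 31))))))))))

variable {n k t : ℕ} {G : SimpleGraph ℕ} {env : ℕ → ℕ}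

theorem sat_inHull (x : ℕ) :
    (inHull x).Sat G env ↔ InHull G (env 3) (env 4) (env x) := by
  simp [inHull, InHull]

@[simp] theorem eval_add (a b : Tm) : (add a b).eval G env = a.eval G env + b.eval G env := rfl

open Classical in
theorem eval_count_inHull (h0 : env 0 = n) : (count 30 (inHull 30)).eval G env =
    ((Finset.range n).filter (InHull G (env 3) (env 4))).card :=
  eval_count_of h0 fun v => by simp [sat_inHull]

theorem sat_closed (h0 : env 0 = n) :
    (closed t).Sat G env ↔ ClosedRule t (Finset.range n) G (env 3) (env 4) := by
  simp only [closed, hullClique, ClosedRule, sat_and, sat_adj, sat_all, sat_imp, sat_inHull, sat_not,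
    sat_eq, eval_var, sat_const, sat_lt, eval_count_inHull h0, eval_const, Finset.mem_range]
  simp [h0]

theorem sat_forced (h0 : env 0 = n) (h1 : env 1 = k) :
    forced.Sat G env ↔ ForcedRule (Finset.range n) G k (env 3) (env 4) := by
  classical
  have hin : ∀ a, (count 31 (.and (.and (.adj 3 31) (.adj 4 31))
      (.and (.not (.eq (.var 31) (.var 30))) (.not (.adj 30 31))))).eval G
        (Function.update env 30 a) = ((Finset.range n).filter fun b =>
          (G.Adj (env 3) b ∧ G.Adj (env 4) b) ∧ b ≠ a ∧ ¬ G.Adj a b).card :=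
    fun a => eval_count_of (by simp [h0]) fun v => by simp
  simp only [forced, ForcedRule, sat_and, sat_adj, sat_le, sat_lt, eval_var, eval_const]
  rw [eval_count_of h0 (p := fun a => (G.Adj (env 3) a ∧ G.Adj (env 4) a) ∧
    k < ((Finset.range n).filter fun b =>
      (G.Adj (env 3) b ∧ G.Adj (env 4) b) ∧ b ≠ a ∧ ¬ G.Adj a b).card), h1]
  · convert Iff.rfl
  · intro a
    simp only [sat_and, sat_adj, sat_lt, eval_var, hin]
    simp [h1]

theorem sat_detach (h0 : env 0 = n) (h1 : env 1 = k) :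
    detach.Sat G env ↔ DetachRule (Finset.range n) G k (env 3) (env 4) := by
  simp only [detach, hullClique, DetachRule, sat_and, sat_adj, sat_all, sat_imp, sat_inHull, sat_not,
    sat_eq, eval_var, sat_le, eval_count_inHull h0, eval_const, sat_ex, eval_add, Finset.mem_range]
  simp [h0, h1, two_mul]

end Tm

/-! ### Combination of the rules into one reduction step -/

/-- The graph obtained by applying the first applicable rule to the edge `qw`. -/
def reduceStep (t n k : ℕ) (G : SimpleGraph ℕ) (q w : ℕ) : SimpleGraph ℕ where
  Adj a b := G.Adj a b ∧
    ¬ (ClosedRule t (Finset.range n) G q w ∧ InHull G q w a ∧ InHull G q w b) ∧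
    ¬ ((¬ ClosedRule t (Finset.range n) G q w ∧ ForcedRule (Finset.range n) G k q w) ∧
      ((a = q ∧ b = w) ∨ (a = w ∧ b = q))) ∧
    ¬ ((¬ ClosedRule t (Finset.range n) G q w ∧ ¬ ForcedRule (Finset.range n) G k q w) ∧
      ((a = q ∧ InHull G q w b) ∨ (b = q ∧ InHull G q w a)))
  symm := ⟨fun a b => by
    rw [G.adj_comm a b]
    tauto⟩
  loopless := ⟨fun a h => G.loopless.irrefl a h.1⟩

theorem InHull.mem_of_adj {n : ℕ} {G : SimpleGraph ℕ} (hG : ∀ i j, G.Adj i j → i < n) {q w a : ℕ}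
    (hqw : G.Adj q w) (h : InHull G q w a) : a < n := by
  rcases h with rfl | rfl | h
  · exact hG _ _ hqw
  · exact hG _ _ hqw.symm
  · exact hG _ _ h.1.symm

open Classical in
theorem yes_reduceStep {t n k : ℕ} {G : SimpleGraph ℕ} (hG : ∀ i j, G.Adj i j → i < n) {q w : ℕ}
    (h : ClosedRule t (Finset.range n) G q w ∨ ForcedRule (Finset.range n) G k q w ∨
      (t = 0 ∧ DetachRule (Finset.range n) G k q w)) :
    Yes t G k ↔ Yes t (reduceStep t n k G q w)
      (k - if ¬ ClosedRule t (Finset.range n) G q w ∧ ForcedRule (Finset.range n) G k q w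
        then 1 else 0) := by
  have hmem : ∀ {a}, G.Adj q w → (a ∈ (Finset.range n).filter (InHull G q w) ↔ InHull G q w a) :=
    fun hqw => by
      rw [Finset.mem_filter, Finset.mem_range]
      exact ⟨fun h => h.2, fun h => ⟨h.mem_of_adj hG hqw, h⟩⟩
  by_cases hc : ClosedRule t (Finset.range n) G q w
  · rw [if_neg (by tauto), Nat.sub_zero]
    obtain ⟨h1, h2, h3, h4⟩ := id hc
    refine yes_closedClique (K := (Finset.range n).filter (InHull G q w)) ?_ ?_ h4 ?_
    · intro a ha b hb hab
      rw [Finset.mem_filter] at ha hb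
      exact h2 a ha.1 b hb.1 ha.2 hb.2 hab
    · intro a ha b hb hab c hac hbc
      rw [Finset.mem_filter] at ha hb
      have hcn := hG _ _ hac.symm
      rw [hmem h1]
      exact h3 a ha.1 b hb.1 c (Finset.mem_range.2 hcn) ha.2 hb.2 hab hac hbc
    · intro a b
      rw [hmem h1, hmem h1]
      simp only [reduceStep]
      tauto
  by_cases hf : ForcedRule (Finset.range n) G k q w
  · rw [if_pos ⟨hc, hf⟩]
    obtain ⟨h1, h2, h3⟩ := id hf
    refine yes_forcedEdge (C := (Finset.range n).filter fun a => G.Adj q a ∧ G.Adj w a) h1 ?_ h2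
      ⟨_, ?_, h3, ?_⟩ ?_
    · intro a ha
      exact (Finset.mem_filter.1 ha).2
    · intro a ha
      simp only [Finset.mem_filter] at ha ⊢
      exact ⟨ha.1, ha.2.1⟩
    · intro a ha
      have ha' := ha
      simp only [Finset.mem_filter] at ha'
      refine ⟨_, ?_, ha'.2.2, ?_⟩
      · intro b hb
        simp only [Finset.mem_filter] at hb ⊢
        exact ⟨hb.1, hb.2.1⟩
      · intro b hb
        simp only [Finset.mem_filter] at hb
        exact hb.2.2
    · intro a b
      simp only [reduceStep, ne_eq, Sym2.eq_iff]
      tauto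
  · rw [if_neg (by tauto), Nat.sub_zero]
    obtain ⟨rfl, hd⟩ := (h.resolve_left hc).resolve_left hf
    obtain ⟨h1, h2, h3, h4, h5⟩ := id hd
    refine yes_detach (q := q) (K := (Finset.range n).filter (InHull G q w))
      ((hmem h1).2 (.inl rfl)) ?_ ?_ h4 ?_ ?_
    · intro a ha b hb hab
      rw [Finset.mem_filter] at ha hb
      exact h2 a ha.1 b hb.1 ha.2 hb.2 hab
    · intro v hv hvq c hqc hvc
      rw [hmem h1]
      rw [Finset.mem_filter] at hv
      exact h3 v hv.1 c (Finset.mem_range.2 (hG _ _ hqc.symm)) hv.2 hvq hqc hvc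
    · intro v hv
      rw [hmem h1] at hv
      by_cases hvn : v < n
      · obtain ⟨y, hy, hyK, hyq, hvy⟩ := h5 v (Finset.mem_range.2 hvn) hv
        exact ⟨y, (hmem h1).2 hyK, hyq, hvy⟩
      -- A vertex outside the range is isolated, so `w` serves as the non-neighbour.
      · exact ⟨w, (hmem h1).2 (.inr (.inl rfl)), h1.ne', fun h => hvn (hG _ _ h)⟩
    · intro a b
      rw [hmem h1, hmem h1]
      simp only [reduceStep]
      tauto

/-- Whichever case of the step is used, the edge `qw` itself is removed. -/
theorem reduceStep_lt {t n k : ℕ} {G : SimpleGraph ℕ} {q w : ℕ} (hqw : G.Adj q w) :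
    reduceStep t n k G q w < G := by
  refine lt_of_le_not_ge (fun a b h => h.1) fun hle => ?_
  have h := hle hqw
  have h1 : InHull G q w q := .inl rfl
  have h2 : InHull G q w w := .inr (.inl rfl)
  simp only [reduceStep] at h
  tauto

/-- The combination of the three rules. -/
noncomputable def reductionRule (t : ℕ) (B : ℕ → ℕ) (big : Tm)
    (hbig : ∀ k G env, env 1 = k → big.eval G env = B k)
    (hB : ∀ n k G, (∀ i j, G.Adj i j → i < n) →
      (∀ q w, ¬ ClosedRule t (Finset.range n) G q w) →
      (∀ q w, ¬ ForcedRule (Finset.range n) G k q w) →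
      (t = 0 → ∀ q w, ¬ DetachRule (Finset.range n) G k q w) → Yes t G k →
      ∀ F : Finset ℕ, (∀ v ∈ F, ∃ u, G.Adj v u) → F.card ≤ B k) : ReductionRule t B where
  -- The constant `t` serves as a truth value: detaching is available only for `t = 0`.
  cond := .or (.closed t) (.or .forced (.and (.not (.const t)) .detach))
  phi := .and (.adj 8 9) (.and (.not (.and (.closed t) (.and (.inHull 8) (.inHull 9))))
    (.and (.not (.and (.and (.not (.closed t)) .forced)
      (.or (.and (.eq (.var 8) (.var 3)) (.eq (.var 9) (.var 4)))
        (.and (.eq (.var 8) (.var 4)) (.eq (.var 9) (.var 3))))))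
    (.not (.and (.and (.not (.closed t)) (.not .forced))
      (.or (.and (.eq (.var 8) (.var 3)) (.inHull 9))
        (.and (.eq (.var 9) (.var 3)) (.inHull 8)))))))
  dec := .bool (.and (.not (.closed t)) .forced)
  big := big
  Applies n k G q w := ClosedRule t (Finset.range n) G q w ∨
    ForcedRule (Finset.range n) G k q w ∨ (t = 0 ∧ DetachRule (Finset.range n) G k q w)
  step := reduceStep t
  drop n k G q w := open Classical in
    if ¬ ClosedRule t (Finset.range n) G q w ∧ ForcedRule (Finset.range n) G k q w then 1 else 0
  sat_cond := by
    rintro n k G q w env h0 h1 rfl rfl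
    simp only [Tm.sat_or, Tm.sat_and, Tm.sat_not, Tm.sat_const, Tm.sat_closed h0,
      Tm.sat_forced h0 h1, Tm.sat_detach h0 h1, not_not]
  sat_phi := by
    rintro n k G q w a b env h0 h1 rfl rfl rfl rfl
    simp only [Tm.sat_or, Tm.sat_and, Tm.sat_not, Tm.sat_adj, Tm.sat_closed h0,
      Tm.sat_forced h0 h1, Tm.sat_inHull, Tm.sat_eq, Tm.eval_var, reduceStep]
  eval_dec := by
    rintro n k G q w env h0 h1 rfl rfl
    rw [Tm.eval_bool]
    have h : (Tm.and (.not (.closed t)) .forced).Sat G env ↔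
        ¬ ClosedRule t (Finset.range n) G (env 3) (env 4) ∧
          ForcedRule (Finset.range n) G k (env 3) (env 4) := by
      simp only [Tm.sat_and, Tm.sat_not, Tm.sat_closed h0, Tm.sat_forced h0 h1]
    by_cases hs : (Tm.and (.not (.closed t)) .forced).Sat G env
    · rw [if_pos hs, if_pos (h.1 hs)]
    · rw [if_neg hs, if_neg (mt h.2 hs)]
  eval_big := hbig
  step_lt := by
    rintro n k G q w - (h | h | h)
    · exact reduceStep_lt h.1
    · exact reduceStep_lt h.1
    · exact reduceStep_lt h.2.1
  yes_step := fun n k G q w hG h => yes_reduceStep hG h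
  bound := by
    intro n k G hG h hy F hF
    have hlt : ∀ {q w}, G.Adj q w → q < n ∧ w < n := fun h => ⟨hG _ _ h, hG _ _ h.symm⟩
    refine hB n k G hG (fun q w hr => ?_) (fun q w hr => ?_) (fun ht q w hr => ?_) hy F hF
    · exact h q (hlt hr.1).1 w (hlt hr.1).2 (.inl hr)
    · exact h q (hlt hr.1).1 w (hlt hr.1).2 (.inr (.inl hr))
    · exact h q (hlt hr.1).1 w (hlt hr.1).2 (.inr (.inr ⟨ht, hr⟩))

/-! ### The cubic and the quadratic kernel -/

theorem subset_nonisolated {n : ℕ} {G : SimpleGraph ℕ} (hG : ∀ i j, G.Adj i j → i < n)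
    [DecidablePred fun v => ∃ u, G.Adj v u] {F : Finset ℕ} (hF : ∀ v ∈ F, ∃ u, G.Adj v u) :
    F ⊆ (Finset.range n).filter fun v => ∃ u, G.Adj v u := fun v hv => by
  obtain ⟨u, hu⟩ := hF v hv
  exact Finset.mem_filter.2 ⟨Finset.mem_range.2 (hG _ _ hu), u, hu⟩

theorem hasKernelization_diamond : HasKernelization diamondFamily fun k => 34 * k ^ 3 := by
  classical
  refine (reductionRule 0 (fun k => 34 * k ^ 3)
    -- Terms have no multiplication; nested sums up to the parameter, held in variable `1`, produce
    -- the power of `k`.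
    (.sum 30 1 (.sum 31 1 (.sum 32 1 (.const 34)))) ?_ ?_).hasKernelization (by norm_num) ?_
    fun n G => isFree_diamondFamily_iff G
  · rintro k G env rfl
    simp [Tm.eval]
    ring
  · intro n k G hG hc hf hd hy F hF
    exact (Finset.card_le_card (subset_nonisolated hG hF)).trans
      (card_nonisolated_le_of_yes (fun a b h => Finset.mem_range.2 (hG a b h)) hy hc hf (hd rfl))
  · intro a b hab
    dsimp only
    gcongr

theorem hasKernelization_diamondClique {t : ℕ} (ht : 4 ≤ t) :
    HasKernelization (diamondCliqueFamily t) fun k => 10 * t * k ^ 2 := by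
  classical
  refine (reductionRule t (fun k => 10 * t * k ^ 2)
    (.sum 30 1 (.sum 31 1 (.const (10 * t)))) ?_ ?_).hasKernelization (by omega) ?_
    fun n G => isFree_diamondCliqueFamily_iff (by omega) G
  · rintro k G env rfl
    simp [Tm.eval]
    ring
  · intro n k G hG hc hf _ hy F hF
    exact (Finset.card_le_card (subset_nonisolated hG hF)).trans
      (card_nonisolated_le_of_yes_clique (by omega) (fun a b h => Finset.mem_range.2 (hG a b h))
        hy hc hf)
  · intro a b hab
    dsimp only
    gcongr

end EdgeDeletion

theorem mainTheorem1 :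
    (∃ C : ℕ, EdgeDeletion.HasKernelization EdgeDeletion.diamondFamily (fun k => C * k ^ 3)) ∧
    (∀ t : ℕ, 4 ≤ t →
      ∃ C : ℕ, EdgeDeletion.HasKernelization (EdgeDeletion.diamondCliqueFamily t)
        (fun k => C * k ^ 2)) :=
  ⟨⟨34, EdgeDeletion.hasKernelization_diamond⟩,
    fun t ht => ⟨10 * t, EdgeDeletion.hasKernelization_diamondClique ht⟩⟩
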